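/- **Conventions.** Let $A$ be a commutative ring and $I\subsetneq A$ a proper ideal, $\widetilde A=A/I$. Write $\xi=(\xi_1,\dots,\xi_m)$, $\rho=(\rho_1,\dots,\rho_n)$. For a valued field $K$ (Krull valuation of arbitrary rank, possibly trivial) let $K^\circ$ be its valuation ring and $K^{\circ\circ}$ the maximal ideal of $K^\circ$. *Separated Weierstrass systems.* A separated $(A,I)$-system is a family ${\cal A}=\{A_{m,n}\}$ of $A$-subalgebras $A_{m,n}\subseteq A[[\xi,\rho]]$ with $A_{0,0}=A$ such that for $m\le m'$, $n\le n'$: $A_{m,n}[\xi_{m+1},\dots,\xi_{m'},\rho_{n+1},\dots,\rho_{n'}]\subseteq A_{m',n'}$; the image of $A_{m,n}$ in $\widetilde A[[\xi,\rho]]$ lies in $\widetilde A[\xi][[\rho]]$; and if $f=\sum_{\mu,\nu}\overline f_{\mu\nu}(\xi,\rho)(\xi'')^\mu(\rho'')^\nu\in A_{m',n'}$, where $\xi'',\rho''$ are the additional variables, then all $\overline f_{\mu\nu}\in A_{m,n}$. Let $J$ be the ideal of power series with all coefficients in $I$. A series $f$ is regular in $\xi_i$ of degree $d$ if modulo $J+(\rho)$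 it is congruent to a monic polynomial of degree $d$ in $\xi_i$ (with coefficients in the power series ring in the other variables), and regular in $\rho_j$ of degree $d$ if $f\equiv\rho_j^d$ modulo $J+(\rho_k\ (k\neq j),\rho_j^{d+1})$. Weierstrass division is required: if $f,g\in A_{m,n}$ and $f$ is regular of degree $d$ in one of the variables $z$ (any $\xi_i$ or any $\rho_j$), there are unique $q,r\in A_{m,n}$ with $g=qf+r$, where $r$ is a polynomial in $z$ of degree $\le d-1$ whose coefficients are elements of $A_{m,n}$ not involving $z$. The rings of ${\cal A}$-fractions $C$, with ideal $C^\circ$ and rings $C_{m,n}$, are defined inductively: $A$ is one, with ideal $I$ and the rings $A_{m,n}$; and if $B$ is one and $c,d\in B$, so is each of the following, provided $C^\circ\ne C$: - $C=B/dB$, with $C^\circ=B^\circ C$ and $C_{m,n}=B_{m,n}/dB_{m,n}$; - $C=B_{1,0}/(d\xi_1-c)$, with $C^\circ=B^\circ C$ and $C_{m,n}=B_{m+1,n}/(d\xi_1-c)$; - $C=B_{0,1}/(d\rho_1-c)$, with $C^\circ=(B^\circ,\rho_1)C$ and $C_{m,n}=B_{m,n+1}/(d\rho_1-c)$. Put $C_{m,n}^\circ=(C^\circ,\rho)C_{m,n}$.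 Then ${\cal A}$ is a separated Weierstrass system if in addition, for each ring $C$ of ${\cal A}$-fractions, every $f=\sum\overline c_{\mu\nu}\xi^\mu\rho^\nu\in C_{m,n}$ can be written as $f=\sum_{(\mu,\nu)\in J_0}\overline c_{\mu\nu}\xi^\mu\rho^\nu(1+g_{\mu\nu})$ with $J_0$ finite and $g_{\mu\nu}\in C_{m,n}^\circ$. *Separated analytic structures.* A separated analytic ${\cal A}$-structure on $K$ is a family $\sigma$ of ring homomorphisms $\sigma_{m,n}$ from $A_{m,n}$ to the ring of functions $(K^\circ)^m\times(K^{\circ\circ})^n\to K^\circ$ such that (1) $\sigma_{0,0}(I)\subseteq K^{\circ\circ}$; (2) $\sigma_{m,n}(\xi_i)$ and $\sigma_{m,n}(\rho_j)$ are the $i$-th and the $(m+j)$-th coordinate functions; (3) $\sigma_{m+1,n}$ and $\sigma_{m,n+1}$ extend $\sigma_{m,n}$, functions of fewer variables being identified with functions that do not depend on the remaining coordinates; in particular, $\sigma_{m,n}(f)$ does not depend on the coordinate of a variable not occurring in $f$. *Strictly convergent case.* Fix $\pi\in I$ (so $\pi\ne1$). A strictly convergent $(A,I)$-system ${\cal A}=\{A_m\}$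 is defined in the same way with the variables $\xi$ only, the image of $A_m$ in $\widetilde A[[\xi]]$ being $\widetilde A[\xi]$. Regularity in $\xi_i$ is now taken modulo $J$. The rings of ${\cal A}$-fractions are now obtained from $A$ by the steps $C=B/dB$, $C=B_1/(d\xi_1-c)$ and $C=B_1/(\pi d\xi_1-c)$, always with $C^\circ=B^\circ C\ne C$, with $C_m=B_m/dB_m$, $B_{m+1}/(d\xi_1-c)$ and $B_{m+1}/(\pi d\xi_1-c)$ respectively, and $C_m^\circ=C^\circ C_m$. A strictly convergent Weierstrass system is one satisfying the analogous division and finite-expansion conditions. A strictly convergent analytic ${\cal A}$-structure on $K$ is a family $\sigma$ of ring homomorphisms $\sigma_m$ from $A_m$ to the ring of functions $(K^\circ)^m\to K^\circ$ satisfying the analogues of (1)–(3), with $\sigma_0(\pi)$ a prime element of $K^\circ$. **Theorem.** Let $K$ be a valued field and $K'$ an algebraic extension of $K$, with a valuation extending that of $K$. (i) Let ${\cal A}$ be a separated Weierstrass system and $\sigma$ a separated analytic ${\cal A}$-structure on $K$. Then there is a unique separated analytic ${\cal A}$-structure $\tau$ on $K'$ extending $\sigma$, i.e. such that $\tau_{m,n}(f)$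 restricts to $\sigma_{m,n}(f)$ on $(K^\circ)^m\times(K^{\circ\circ})^n$ for all $m,n$ and $f\in A_{m,n}$. (ii) Let ${\cal A}$ be a strictly convergent Weierstrass system and $\sigma$ a strictly convergent analytic ${\cal A}$-structure on $K$ such that $\sigma_0(\pi)$ remains prime in $(K')^\circ$. Then there is a unique strictly convergent analytic ${\cal A}$-structure $\tau$ on $K'$ extending $\sigma$. -/

import Mathlib

/-!
# Weierstrass systems and valued fields with analytic structure

Power series rings `A[[ξ₁,…,ξₘ,ρ₁,…,ρₙ]]` are realised as subrings of one ring of formal power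
series, `MvPowerSeries (ℕ ⊕ ℕ) A` in the separated case (`Sum.inl i` is the variable `ξ_{i+1}` and
`Sum.inr j` is the variable `ρ_{j+1}`), and `MvPowerSeries ℕ A` in the strictly convergent case
(`i` is the variable `ξ_{i+1}`): the series in which only the listed variables occur.
-/

namespace AnalyticStructure

section PowerSeries

/-- Only variables from `S` occur in the power series `f`, i.e. `f ∈ A[[S]]`. -/
def OnlyVars {ι A : Type*} [CommRing A] (S : Set ι) (f : MvPowerSeries ι A) : Prop :=
  ∀ α : ι →₀ ℕ, MvPowerSeries.coeff α f ≠ 0 → (α.support : Set ι) ⊆ S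

open Classical in
/-- The coefficient `f̄_β ∈ A[[S]]` of `f` at the monomial with exponent `β` in the variables
outside `S`: if `f = ∑_β f̄_β(S) · X^β`, with `β` running over the exponents supported outside `S`,
this is `f̄_β`. -/
noncomputable def partialCoeff {ι A : Type*} [CommRing A] (S : Set ι) (f : MvPowerSeries ι A)
    (β : ι →₀ ℕ) : MvPowerSeries ι A :=
  fun α => if (α.support : Set ι) ⊆ S then MvPowerSeries.coeff (α + β) f else 0

/-- The ideal of all power series with all coefficients in `I`, i.e. the kernel of the residue map
`A[[X]] → (A/I)[[X]]`. -/
noncomputable def residueIdeal {A : Type*} [CommRing A] (ι : Type*) (I : Ideal A) :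
    Ideal (MvPowerSeries ι A) :=
  RingHom.ker (MvPowerSeries.map (σ := ι) (Ideal.Quotient.mk I))

/-- `r` is a polynomial in the variable `X_s`, of degree at most `d - 1`, with coefficients in the
set `R` of power series (so `r = 0` if `d = 0`). -/
def IsPolyOfDegreeLT {ι A : Type*} [CommRing A] (R : Set (MvPowerSeries ι A)) (s : ι) (d : ℕ)
    (r : MvPowerSeries ι A) : Prop :=
  ∃ c : ℕ → MvPowerSeries ι A, (∀ i < d, c i ∈ R) ∧
    r = ∑ i ∈ Finset.range d, c i * MvPowerSeries.X s ^ i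

/-- `P` is a monic polynomial of degree `d` in the variable `X_s` with coefficients in `R`. -/
def IsMonicPolyOfDegree {ι A : Type*} [CommRing A] (R : Set (MvPowerSeries ι A)) (s : ι) (d : ℕ)
    (P : MvPowerSeries ι A) : Prop :=
  ∃ r, IsPolyOfDegreeLT R s d r ∧ P = MvPowerSeries.X s ^ d + r

end PowerSeries

/-! ### Separated systems -/

/-- The variables `ξ₁,…,ξₘ,ρ₁,…,ρₙ`. -/
def sepVars (m n : ℕ) : Set (ℕ ⊕ ℕ) := {s | Sum.elim (· < m) (· < n) s}

/-- The exponent `β` of a monomial in `ξ''₁,…,ξ''ₘ,ρ''₁,…,ρ''ₙ`, where `ξ''ᵢ = ξ_{k+i}` and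
`ρ''ⱼ = ρ_{l+j}`. -/
noncomputable def sepExponent (k l : ℕ) {m n : ℕ} (β : Fin m ⊕ Fin n →₀ ℕ) : ℕ ⊕ ℕ →₀ ℕ :=
  β.mapDomain (Sum.map (fun i : Fin m => k + (i : ℕ)) (fun j : Fin n => l + (j : ℕ)))

/-- A separated `(A, I)`-system: rings `ring m n = A_{m,n} ⊆ A[[ξ₁,…,ξₘ,ρ₁,…,ρₙ]]`. -/
structure SeparatedSystem (A : Type*) [CommRing A] (I : Ideal A) where
  /-- the rings `A_{m,n}` -/
  ring : ℕ → ℕ → Subalgebra A (MvPowerSeries (ℕ ⊕ ℕ) A)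
  /-- `A_{0,0} = A` -/
  ring_zero : ring 0 0 = ⊥
  /-- `A_{m,n} ⊆ A[[ξ,ρ]]` -/
  onlyVars : ∀ m n, ∀ f ∈ ring m n, OnlyVars (sepVars m n) f
  /-- `A_{m,n}[ξ'',ρ''] ⊆ A_{m',n'}` -/
  adjoin_le : ∀ m n m' n', m ≤ m' → n ≤ n' →
    ring m n ⊔ Algebra.adjoin A (MvPowerSeries.X '' (sepVars m' n' \ sepVars m n)) ≤ ring m' n'
  /-- the image of `A_{m,n}` in `(A/I)[[ξ,ρ]]` is contained in `(A/I)[ξ][[ρ]]` -/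
  residue : ∀ m n, ∀ f ∈ ring m n, ∀ ν : ℕ →₀ ℕ,
    {μ : ℕ →₀ ℕ | MvPowerSeries.coeff (Finsupp.sumElim μ ν) f ∉ I}.Finite
  /-- if `f = ∑ f̄_{μν}(ξ,ρ) ξ''^μ ρ''^ν ∈ A_{m+p,n+q}`, then the `f̄_{μν}` are in `A_{m,n}` -/
  partialCoeff_mem : ∀ m n p q, ∀ f ∈ ring (m + p) (n + q), ∀ β : Fin p ⊕ Fin q →₀ ℕ,
    partialCoeff (sepVars m n) f (sepExponent m n β) ∈ ring m n

/-- `f` is regular in the variable `ξ_{i+1}` of degree `d`: it is congruent to a monic polynomial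
of degree `d` in this variable modulo the series with coefficients in `I` and `(ρ₁,…,ρₙ)`. -/
def IsRegularXi {A : Type*} [CommRing A] (I : Ideal A) (m n i d : ℕ)
    (f : MvPowerSeries (ℕ ⊕ ℕ) A) : Prop :=
  ∃ P, IsMonicPolyOfDegree {a | OnlyVars (sepVars m n \ {Sum.inl i}) a} (Sum.inl i) d P ∧
    f - P ∈ residueIdeal (ℕ ⊕ ℕ) I ⊔
      Ideal.span {x | ∃ j < n, x = MvPowerSeries.X (Sum.inr j)}

/-- `f` is regular in the variable `ρ_{j+1}` of degree `d`: it is congruent to `ρ_{j+1}^d` modulo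
the series with coefficients in `I`, the other `ρ`-variables and `ρ_{j+1}^{d+1}`. -/
def IsRegularRho {A : Type*} [CommRing A] (I : Ideal A) (n j d : ℕ)
    (f : MvPowerSeries (ℕ ⊕ ℕ) A) : Prop :=
  f - MvPowerSeries.X (Sum.inr j) ^ d ∈ residueIdeal (ℕ ⊕ ℕ) I ⊔
    Ideal.span ({x | ∃ j' < n, j' ≠ j ∧ x = MvPowerSeries.X (Sum.inr j')} ∪
      {MvPowerSeries.X (Sum.inr j) ^ (d + 1)})

namespace SeparatedSystem

variable {A : Type*} [CommRing A] {I : Ideal A}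

/-- The two Weierstrass division theorems. A variable `ξ_{i+1}` (or `ρ_{j+1}`) of `A_{m,n}` by
which one divides may be any of the variables; the elements of `A_{m,n}` in which it does not
occur are the coefficients of the remainder. For the last variable `ξₘ` these are the elements of
`A_{m-1,n}`. -/
structure IsPreWeierstrass (𝒜 : SeparatedSystem A I) : Prop where
  division_xi : ∀ m n i d, i < m → ∀ f ∈ 𝒜.ring m n, ∀ g ∈ 𝒜.ring m n,
    IsRegularXi I m n i d f →
    ∃! qr : MvPowerSeries (ℕ ⊕ ℕ) A × MvPowerSeries (ℕ ⊕ ℕ) A, qr.1 ∈ 𝒜.ring m n ∧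
      IsPolyOfDegreeLT {a | a ∈ 𝒜.ring m n ∧ OnlyVars {Sum.inl i}ᶜ a} (Sum.inl i) d qr.2 ∧
      g = qr.1 * f + qr.2
  division_rho : ∀ m n j d, j < n → ∀ f ∈ 𝒜.ring m n, ∀ g ∈ 𝒜.ring m n,
    IsRegularRho I n j d f →
    ∃! qr : MvPowerSeries (ℕ ⊕ ℕ) A × MvPowerSeries (ℕ ⊕ ℕ) A, qr.1 ∈ 𝒜.ring m n ∧
      IsPolyOfDegreeLT {a | a ∈ 𝒜.ring m n ∧ OnlyVars {Sum.inr j}ᶜ a} (Sum.inr j) d qr.2 ∧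
      g = qr.1 * f + qr.2

theorem ring_mono (𝒜 : SeparatedSystem A I) {m n m' n' : ℕ} (hm : m ≤ m') (hn : n ≤ n') :
    𝒜.ring m n ≤ 𝒜.ring m' n' :=
  le_sup_left.trans (𝒜.adjoin_le m n m' n' hm hn)

theorem X_mem (𝒜 : SeparatedSystem A I) {m n : ℕ} {s : ℕ ⊕ ℕ} (hs : s ∈ sepVars m n) :
    MvPowerSeries.X s ∈ 𝒜.ring m n := by
  refine 𝒜.adjoin_le 0 0 m n (Nat.zero_le _) (Nat.zero_le _)
    (le_sup_right (a := 𝒜.ring 0 0) (Algebra.subset_adjoin ⟨s, ⟨hs, ?_⟩, rfl⟩))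
  rcases s with i | i <;> simp [sepVars]

/-- The inclusion `A_{m,n} ⊆ A_{m',n'}`. -/
noncomputable def incl (𝒜 : SeparatedSystem A I) {m n m' n' : ℕ} (hm : m ≤ m') (hn : n ≤ n') :
    𝒜.ring m n →ₐ[A] 𝒜.ring m' n' :=
  Subalgebra.inclusion (𝒜.ring_mono hm hn)

/-- The variable `ξ_{i+1}` in `A_{m,n}`. -/
noncomputable def xi (𝒜 : SeparatedSystem A I) (m n : ℕ) (i : Fin m) : 𝒜.ring m n :=
  ⟨MvPowerSeries.X (Sum.inl (i : ℕ)), 𝒜.X_mem i.2⟩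

/-- The variable `ρ_{j+1}` in `A_{m,n}`. -/
noncomputable def rho (𝒜 : SeparatedSystem A I) (m n : ℕ) (j : Fin n) : 𝒜.ring m n :=
  ⟨MvPowerSeries.X (Sum.inr (j : ℕ)), 𝒜.X_mem j.2⟩

/-- A presentation of a quotient ring `C = A_{k,l}/rel` together with an ideal `C° = top/rel` of
it and the rings `C_{m,n} = A_{k+m,l+n}/rel·A_{k+m,l+n}`, in which the images of
`ξ_{k+1},…,ξ_{k+m},ρ_{l+1},…,ρ_{l+n}` are the `m + n` variables. All rings of `𝒜`-fractions have
this form. -/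
structure FractionRing (𝒜 : SeparatedSystem A I) where
  k : ℕ
  l : ℕ
  rel : Ideal (𝒜.ring k l)
  top : Ideal (𝒜.ring k l)

namespace FractionRing

variable {𝒜 : SeparatedSystem A I}

/-- `C = A` with `C° = I` and `C_{m,n} = A_{m,n}`. -/
noncomputable def base (𝒜 : SeparatedSystem A I) : 𝒜.FractionRing where
  k := 0
  l := 0
  rel := ⊥
  top := I.map (algebraMap A (𝒜.ring 0 0))

/-- `C = B/dB`, with `C°` the image of `B°` and `C_{m,n} = B_{m,n}/dB_{m,n}`. -/
noncomputable def quot (B : 𝒜.FractionRing) (d : 𝒜.ring B.k B.l) : 𝒜.FractionRing where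
  k := B.k
  l := B.l
  rel := B.rel ⊔ Ideal.span {d}
  top := B.top ⊔ Ideal.span {d}

/-- `C = B⟨c/d⟩ = B_{1,0}/(dξ₁ - c)`, with `C° = B°C` and `C_{m,n} = B_{m+1,n}/(dξ₁ - c)`. -/
noncomputable def fracLE (B : 𝒜.FractionRing) (c d : 𝒜.ring B.k B.l) : 𝒜.FractionRing where
  k := B.k + 1
  l := B.l
  rel := B.rel.map (𝒜.incl B.k.le_succ le_rfl) ⊔
    Ideal.span {𝒜.incl B.k.le_succ le_rfl d * 𝒜.xi (B.k + 1) B.l (Fin.last B.k) -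
      𝒜.incl B.k.le_succ le_rfl c}
  top := B.top.map (𝒜.incl B.k.le_succ le_rfl) ⊔
    Ideal.span {𝒜.incl B.k.le_succ le_rfl d * 𝒜.xi (B.k + 1) B.l (Fin.last B.k) -
      𝒜.incl B.k.le_succ le_rfl c}

/-- `C = B[[c/d]]ₛ = B_{0,1}/(dρ₁ - c)`, with `C° = (B°, ρ₁)C` and
`C_{m,n} = B_{m,n+1}/(dρ₁ - c)`. -/
noncomputable def fracLT (B : 𝒜.FractionRing) (c d : 𝒜.ring B.k B.l) : 𝒜.FractionRing where
  k := B.k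
  l := B.l + 1
  rel := B.rel.map (𝒜.incl le_rfl B.l.le_succ) ⊔
    Ideal.span {𝒜.incl le_rfl B.l.le_succ d * 𝒜.rho B.k (B.l + 1) (Fin.last B.l) -
      𝒜.incl le_rfl B.l.le_succ c}
  top := B.top.map (𝒜.incl le_rfl B.l.le_succ) ⊔
    Ideal.span {𝒜.incl le_rfl B.l.le_succ d * 𝒜.rho B.k (B.l + 1) (Fin.last B.l) -
      𝒜.incl le_rfl B.l.le_succ c, 𝒜.rho B.k (B.l + 1) (Fin.last B.l)}

/-- The rings of `𝒜`-fractions. Elements `c, d` of `B` are given by representatives in `A_{k,l}`;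
`C° ≠ C` says that the preimage `C.top` of `C°` is not the unit ideal. -/
inductive IsRingOfFractions (𝒜 : SeparatedSystem A I) : 𝒜.FractionRing → Prop
  | base : IsRingOfFractions 𝒜 (base 𝒜)
  | quot (B : 𝒜.FractionRing) (d : 𝒜.ring B.k B.l) :
      IsRingOfFractions 𝒜 B → (B.quot d).top ≠ ⊤ → IsRingOfFractions 𝒜 (B.quot d)
  | fracLE (B : 𝒜.FractionRing) (c d : 𝒜.ring B.k B.l) :
      IsRingOfFractions 𝒜 B → (B.fracLE c d).top ≠ ⊤ → IsRingOfFractions 𝒜 (B.fracLE c d)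
  | fracLT (B : 𝒜.FractionRing) (c d : 𝒜.ring B.k B.l) :
      IsRingOfFractions 𝒜 B → (B.fracLT c d).top ≠ ⊤ → IsRingOfFractions 𝒜 (B.fracLT c d)

variable (C : 𝒜.FractionRing) (m n : ℕ)

/-- The inclusion `A_{k,l} ⊆ A_{k+m,l+n}`. -/
noncomputable def toExt : 𝒜.ring C.k C.l →ₐ[A] 𝒜.ring (C.k + m) (C.l + n) :=
  𝒜.incl (Nat.le_add_right _ _) (Nat.le_add_right _ _)

/-- The ring `C_{m,n}` of separated power series over `C`. -/
abbrev Series : Type _ := 𝒜.ring (C.k + m) (C.l + n) ⧸ C.rel.map (C.toExt m n)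

/-- The quotient map `A_{k+m,l+n} → C_{m,n}`. -/
noncomputable def toSeries : 𝒜.ring (C.k + m) (C.l + n) →+* C.Series m n :=
  Ideal.Quotient.mk (C.rel.map (C.toExt m n))

/-- The variables `ξ` (`Sum.inl`) and `ρ` (`Sum.inr`) of `C_{m,n}`, lifted to `A_{k+m,l+n}`. -/
noncomputable def var : Fin m ⊕ Fin n → 𝒜.ring (C.k + m) (C.l + n) :=
  Sum.elim (fun i => 𝒜.xi _ _ (Fin.natAdd C.k i)) (fun j => 𝒜.rho _ _ (Fin.natAdd C.l j))

/-- The ideal `C_{m,n}° = (C°, ρ)C_{m,n}`. -/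
noncomputable def seriesIdeal : Ideal (C.Series m n) :=
  (C.top.map (C.toExt m n) ⊔
    Ideal.span (Set.range fun j : Fin n => C.var m n (Sum.inr j))).map (C.toSeries m n)

/-- The coefficient `c̄_β`, lifted to `A_{k,l}`, of the series in `C_{m,n}` represented by `f`. Its
image in `C` depends only on the image of `f` in `C_{m,n}`. -/
noncomputable def coeff (f : 𝒜.ring (C.k + m) (C.l + n)) (β : Fin m ⊕ Fin n →₀ ℕ) :
    𝒜.ring C.k C.l :=
  ⟨partialCoeff (sepVars C.k C.l) (f : MvPowerSeries (ℕ ⊕ ℕ) A) (sepExponent C.k C.l β),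
    𝒜.partialCoeff_mem _ _ _ _ _ f.2 β⟩

/-- Every `f = ∑ c̄_{μν} ξ^μ ρ^ν` in `C_{m,n}` is a finite sum `∑_J c̄_{μν} ξ^μ ρ^ν (1 + g_{μν})`
with `g_{μν} ∈ C_{m,n}°`. -/
def HasFiniteExpansions : Prop :=
  ∀ (m n : ℕ) (f : 𝒜.ring (C.k + m) (C.l + n)),
    ∃ (J : Finset (Fin m ⊕ Fin n →₀ ℕ)) (g : (Fin m ⊕ Fin n →₀ ℕ) → C.Series m n),
      (∀ β ∈ J, g β ∈ C.seriesIdeal m n) ∧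
      C.toSeries m n f = ∑ β ∈ J, C.toSeries m n (C.toExt m n (C.coeff m n f β)) *
        (β.prod fun s a => C.toSeries m n (C.var m n s) ^ a) * (1 + g β)

end FractionRing

/-- A separated Weierstrass system. -/
structure IsWeierstrass (𝒜 : SeparatedSystem A I) : Prop extends 𝒜.IsPreWeierstrass where
  finiteExpansions : ∀ C : 𝒜.FractionRing,
    FractionRing.IsRingOfFractions 𝒜 C → C.HasFiniteExpansions

end SeparatedSystem

/-! ### Strictly convergent systems -/

/-- A strictly convergent `(A, I)`-system: rings `ring m = Aₘ ⊆ A[[ξ₁,…,ξₘ]]`. -/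
structure StrictSystem (A : Type*) [CommRing A] (I : Ideal A) where
  /-- the rings `Aₘ` -/
  ring : ℕ → Subalgebra A (MvPowerSeries ℕ A)
  /-- `A₀ = A` -/
  ring_zero : ring 0 = ⊥
  /-- `Aₘ ⊆ A[[ξ]]` -/
  onlyVars : ∀ m, ∀ f ∈ ring m, OnlyVars (Set.Iio m) f
  /-- `Aₘ[ξ_{m+1},…,ξ_{m'}] ⊆ A_{m'}` -/
  adjoin_le : ∀ m m', m ≤ m' →
    ring m ⊔ Algebra.adjoin A (MvPowerSeries.X '' (Set.Iio m' \ Set.Iio m)) ≤ ring m'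
  /-- the image of `Aₘ` in `(A/I)[[ξ]]` is contained in `(A/I)[ξ]`; that it contains `(A/I)[ξ]` is
  a consequence of `adjoin_le` -/
  residue : ∀ m, ∀ f ∈ ring m, {μ : ℕ →₀ ℕ | MvPowerSeries.coeff μ f ∉ I}.Finite
  /-- if `f = ∑ f̄_μ(ξ) ξ''^μ ∈ A_{m+p}`, then the `f̄_μ` are in `Aₘ` -/
  partialCoeff_mem : ∀ m p, ∀ f ∈ ring (m + p), ∀ β : Fin p →₀ ℕ,
    partialCoeff (Set.Iio m) f (β.mapDomain fun i : Fin p => m + (i : ℕ)) ∈ ring m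

/-- `f` is regular in the variable `ξ_{i+1}` of degree `d`: it is congruent to a monic polynomial
of degree `d` in this variable modulo the series with coefficients in `I`. -/
def IsRegularStrict {A : Type*} [CommRing A] (I : Ideal A) (m i d : ℕ)
    (f : MvPowerSeries ℕ A) : Prop :=
  ∃ P, IsMonicPolyOfDegree {a | OnlyVars (Set.Iio m \ {i}) a} i d P ∧ f - P ∈ residueIdeal ℕ I

namespace StrictSystem

variable {A : Type*} [CommRing A] {I : Ideal A}

/-- The Weierstrass division theorem, for division by any of the variables of `Aₘ`. -/
def IsPreWeierstrass (𝒜 : StrictSystem A I) : Prop :=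
  ∀ m i d, i < m → ∀ f ∈ 𝒜.ring m, ∀ g ∈ 𝒜.ring m, IsRegularStrict I m i d f →
    ∃! qr : MvPowerSeries ℕ A × MvPowerSeries ℕ A, qr.1 ∈ 𝒜.ring m ∧
      IsPolyOfDegreeLT {a | a ∈ 𝒜.ring m ∧ OnlyVars {i}ᶜ a} i d qr.2 ∧
      g = qr.1 * f + qr.2

theorem ring_mono (𝒜 : StrictSystem A I) {m m' : ℕ} (hm : m ≤ m') : 𝒜.ring m ≤ 𝒜.ring m' :=
  le_sup_left.trans (𝒜.adjoin_le m m' hm)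

theorem X_mem (𝒜 : StrictSystem A I) {m i : ℕ} (hi : i < m) :
    MvPowerSeries.X i ∈ 𝒜.ring m :=
  𝒜.adjoin_le 0 m (Nat.zero_le _)
    (le_sup_right (a := 𝒜.ring 0) (Algebra.subset_adjoin ⟨i, ⟨hi, by simp⟩, rfl⟩))

/-- The inclusion `Aₘ ⊆ A_{m'}`. -/
noncomputable def incl (𝒜 : StrictSystem A I) {m m' : ℕ} (hm : m ≤ m') : 𝒜.ring m →ₐ[A] 𝒜.ring m' :=
  Subalgebra.inclusion (𝒜.ring_mono hm)

/-- The variable `ξ_{i+1}` in `Aₘ`. -/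
noncomputable def xi (𝒜 : StrictSystem A I) (m : ℕ) (i : Fin m) : 𝒜.ring m :=
  ⟨MvPowerSeries.X (i : ℕ), 𝒜.X_mem i.2⟩

/-- A presentation of a quotient ring `C = A_k/rel` together with an ideal `C° = top/rel` of it and
the rings `C_m = A_{k+m}/rel·A_{k+m}`, in which the images of `ξ_{k+1},…,ξ_{k+m}` are the `m`
variables. All rings of `𝒜`-fractions have this form. -/
structure FractionRing (𝒜 : StrictSystem A I) where
  k : ℕ
  rel : Ideal (𝒜.ring k)
  top : Ideal (𝒜.ring k)

namespace FractionRing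

variable {𝒜 : StrictSystem A I}

/-- `C = A` with `C° = I` and `C_m = A_m`. -/
noncomputable def base (𝒜 : StrictSystem A I) : 𝒜.FractionRing where
  k := 0
  rel := ⊥
  top := I.map (algebraMap A (𝒜.ring 0))

/-- `C = B/dB`, with `C° = B°C` and `C_m = B_m/dB_m`. -/
noncomputable def quot (B : 𝒜.FractionRing) (d : 𝒜.ring B.k) : 𝒜.FractionRing where
  k := B.k
  rel := B.rel ⊔ Ideal.span {d}
  top := B.top ⊔ Ideal.span {d}

/-- `C = B⟨c/d⟩ = B₁/(dξ₁ - c)`, with `C° = B°C` and `C_m = B_{m+1}/(dξ₁ - c)`. -/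
noncomputable def frac (B : 𝒜.FractionRing) (c d : 𝒜.ring B.k) : 𝒜.FractionRing where
  k := B.k + 1
  rel := B.rel.map (𝒜.incl B.k.le_succ) ⊔
    Ideal.span {𝒜.incl B.k.le_succ d * 𝒜.xi (B.k + 1) (Fin.last B.k) - 𝒜.incl B.k.le_succ c}
  top := B.top.map (𝒜.incl B.k.le_succ) ⊔
    Ideal.span {𝒜.incl B.k.le_succ d * 𝒜.xi (B.k + 1) (Fin.last B.k) - 𝒜.incl B.k.le_succ c}

/-- The rings of `𝒜`-fractions, with respect to the fixed element `π` of `A`: they are closed under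
`B ↦ B/dB`, `B ↦ B⟨c/d⟩` and `B ↦ B⟨c/(πd)⟩`, as long as `C° ≠ C`. -/
inductive IsRingOfFractions (𝒜 : StrictSystem A I) (π : A) : 𝒜.FractionRing → Prop
  | base : IsRingOfFractions 𝒜 π (base 𝒜)
  | quot (B : 𝒜.FractionRing) (d : 𝒜.ring B.k) :
      IsRingOfFractions 𝒜 π B → (B.quot d).top ≠ ⊤ → IsRingOfFractions 𝒜 π (B.quot d)
  | fracLE (B : 𝒜.FractionRing) (c d : 𝒜.ring B.k) :
      IsRingOfFractions 𝒜 π B → (B.frac c d).top ≠ ⊤ → IsRingOfFractions 𝒜 π (B.frac c d)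
  | fracLT (B : 𝒜.FractionRing) (c d : 𝒜.ring B.k) :
      IsRingOfFractions 𝒜 π B → (B.frac c (algebraMap A _ π * d)).top ≠ ⊤ →
      IsRingOfFractions 𝒜 π (B.frac c (algebraMap A _ π * d))

variable (C : 𝒜.FractionRing) (m : ℕ)

/-- The inclusion `A_k ⊆ A_{k+m}`. -/
noncomputable def toExt : 𝒜.ring C.k →ₐ[A] 𝒜.ring (C.k + m) := 𝒜.incl (Nat.le_add_right _ _)

/-- The ring `C_m` of strictly convergent functions over `C`. -/
abbrev Series : Type _ := 𝒜.ring (C.k + m) ⧸ C.rel.map (C.toExt m)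

/-- The quotient map `A_{k+m} → C_m`. -/
noncomputable def toSeries : 𝒜.ring (C.k + m) →+* C.Series m := Ideal.Quotient.mk (C.rel.map (C.toExt m))

/-- The variables of `C_m`, lifted to `A_{k+m}`. -/
noncomputable def var (i : Fin m) : 𝒜.ring (C.k + m) := 𝒜.xi _ (Fin.natAdd C.k i)

/-- The ideal `C_m° = C°C_m`. -/
noncomputable def seriesIdeal : Ideal (C.Series m) := (C.top.map (C.toExt m)).map (C.toSeries m)

/-- The coefficient `c̄_β`, lifted to `A_k`, of the series in `C_m` represented by `f`. Its image in
`C` depends only on the image of `f` in `C_m`. -/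
noncomputable def coeff (f : 𝒜.ring (C.k + m)) (β : Fin m →₀ ℕ) : 𝒜.ring C.k :=
  ⟨partialCoeff (Set.Iio C.k) (f : MvPowerSeries ℕ A) (β.mapDomain fun i : Fin m => C.k + (i : ℕ)),
    𝒜.partialCoeff_mem _ _ _ f.2 β⟩

/-- Every `f = ∑ c̄_μ ξ^μ` in `C_m` is a finite sum `∑_J c̄_μ ξ^μ (1 + g_μ)` with `g_μ ∈ C_m°`. -/
def HasFiniteExpansions : Prop :=
  ∀ (m : ℕ) (f : 𝒜.ring (C.k + m)),
    ∃ (J : Finset (Fin m →₀ ℕ)) (g : (Fin m →₀ ℕ) → C.Series m),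
      (∀ β ∈ J, g β ∈ C.seriesIdeal m) ∧
      C.toSeries m f = ∑ β ∈ J, C.toSeries m (C.toExt m (C.coeff m f β)) *
        (β.prod fun s a => C.toSeries m (C.var m s) ^ a) * (1 + g β)

end FractionRing

/-- A strictly convergent Weierstrass system, with respect to the fixed element `π` of `A`. -/
structure IsWeierstrass (𝒜 : StrictSystem A I) (π : A) : Prop where
  isPreWeierstrass : 𝒜.IsPreWeierstrass
  finiteExpansions : ∀ C : 𝒜.FractionRing,
    FractionRing.IsRingOfFractions 𝒜 π C → C.HasFiniteExpansions

end StrictSystem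

/-! ### Analytic structures on valued fields -/

section Fields

variable {A : Type*} [CommRing A] {I : Ideal A}
  {K : Type*} [Field K] {Γ : Type*} [LinearOrderedCommGroupWithZero Γ]
  {K' : Type*} [Field K'] {Γ' : Type*} [LinearOrderedCommGroupWithZero Γ'] [Algebra K K']

/-- The maximal ideal `K°°` of the valuation ring `K° = v.integer`, as a type. -/
def OpenDisc (v : Valuation K Γ) : Type _ := {x : v.integer // v (x : K) < 1}

/-- The map `K°° → K'°°` of an extension of valued fields. -/
def OpenDisc.map (v : Valuation K Γ) (v' : Valuation K' Γ') [v.HasExtension v']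
    (x : OpenDisc v) : OpenDisc v' :=
  ⟨algebraMap v.integer v'.integer x.1,
    (Valuation.HasExtension.val_map_lt_one_iff v v' (x.1 : K)).mpr x.2⟩

/-- A separated analytic `𝒜`-structure on the valued field `(K, v)`: homomorphisms `σ_{m,n}` from
`A_{m,n}` to the ring of `K°`-valued functions on `(K°)^m × (K°°)^n`.

Functions of fewer variables are identified with functions that do not depend on the remaining
coordinates: `map_incl_xi` and `map_incl_rho` say that `σ_{m+1,n}` and `σ_{m,n+1}` extend
`σ_{m,n}`, and `indep_xi` and `indep_rho` say that the function `σ_{m,n}(f)` does not depend on the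
coordinate of a variable that does not occur in `f`. -/
@[ext]
structure SeparatedStructure (𝒜 : SeparatedSystem A I) (v : Valuation K Γ) where
  σ : ∀ m n : ℕ, 𝒜.ring m n →+* ((Fin m → v.integer) × (Fin n → OpenDisc v) → v.integer)
  map_ideal : ∀ a ∈ I, ∀ p, v (σ 0 0 (algebraMap A _ a) p : K) < 1
  map_xi : ∀ m n i p, σ m n (𝒜.xi m n i) p = p.1 i
  map_rho : ∀ m n j p, σ m n (𝒜.rho m n j) p = (p.2 j).1
  map_incl_xi : ∀ (m n : ℕ) (f : 𝒜.ring m n) (x : Fin (m + 1) → v.integer)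
    (y : Fin n → OpenDisc v),
    σ (m + 1) n (𝒜.incl m.le_succ le_rfl f) (x, y) = σ m n f (fun i => x i.castSucc, y)
  map_incl_rho : ∀ (m n : ℕ) (f : 𝒜.ring m n) (x : Fin m → v.integer)
    (y : Fin (n + 1) → OpenDisc v),
    σ m (n + 1) (𝒜.incl le_rfl n.le_succ f) (x, y) = σ m n f (x, fun j => y j.castSucc)
  indep_xi : ∀ (m n : ℕ) (f : 𝒜.ring m n) (i : Fin m),
    OnlyVars {Sum.inl (i : ℕ)}ᶜ (f : MvPowerSeries (ℕ ⊕ ℕ) A) →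
    ∀ (x : Fin m → v.integer) (y : Fin n → OpenDisc v) (a : v.integer),
      σ m n f (Function.update x i a, y) = σ m n f (x, y)
  indep_rho : ∀ (m n : ℕ) (f : 𝒜.ring m n) (j : Fin n),
    OnlyVars {Sum.inr (j : ℕ)}ᶜ (f : MvPowerSeries (ℕ ⊕ ℕ) A) →
    ∀ (x : Fin m → v.integer) (y : Fin n → OpenDisc v) (b : OpenDisc v),
      σ m n f (x, Function.update y j b) = σ m n f (x, y)

/-- The structure `τ` on `K'` extends the structure `σ` on `K`: for all `f` in `A_{m,n}`, the
function of `f` on `(K'°)^m × (K'°°)^n` extends the one on `(K°)^m × (K°°)^n`. -/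
def SeparatedStructure.Extends {𝒜 : SeparatedSystem A I} {v : Valuation K Γ}
    {v' : Valuation K' Γ'} [v.HasExtension v'] (τ : SeparatedStructure 𝒜 v')
    (σ : SeparatedStructure 𝒜 v) : Prop :=
  ∀ (m n : ℕ) (f : 𝒜.ring m n) (x : Fin m → v.integer) (y : Fin n → OpenDisc v),
    τ.σ m n f (fun i => algebraMap v.integer v'.integer (x i),
      fun j => OpenDisc.map v v' (y j)) =
    algebraMap v.integer v'.integer (σ.σ m n f (x, y))

/-- A strictly convergent analytic `𝒜`-structure on the valued field `(K, v)`: homomorphisms `σₘ`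
from `Aₘ` to the ring of `K°`-valued functions on `(K°)^m`, such that `σ₀(π)` is a prime element
of `K°`. (The ring of functions on the point `(K°)^0` is identified with `K°`.) -/
@[ext]
structure StrictStructure (𝒜 : StrictSystem A I) (π : A) (v : Valuation K Γ) where
  σ : ∀ m : ℕ, 𝒜.ring m →+* ((Fin m → v.integer) → v.integer)
  map_ideal : ∀ a ∈ I, ∀ x, v (σ 0 (algebraMap A _ a) x : K) < 1
  prime : ∀ x, Prime (σ 0 (algebraMap A _ π) x)
  map_xi : ∀ m i x, σ m (𝒜.xi m i) x = x i
  map_incl : ∀ (m : ℕ) (f : 𝒜.ring m) (x : Fin (m + 1) → v.integer),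
    σ (m + 1) (𝒜.incl m.le_succ f) x = σ m f (fun i => x i.castSucc)
  indep_xi : ∀ (m : ℕ) (f : 𝒜.ring m) (i : Fin m),
    OnlyVars {(i : ℕ)}ᶜ (f : MvPowerSeries ℕ A) →
    ∀ (x : Fin m → v.integer) (a : v.integer), σ m f (Function.update x i a) = σ m f x

/-- The structure `τ` on `K'` extends the structure `σ` on `K`. -/
def StrictStructure.Extends {𝒜 : StrictSystem A I} {π : A} {v : Valuation K Γ}
    {v' : Valuation K' Γ'} [v.HasExtension v'] (τ : StrictStructure 𝒜 π v')
    (σ : StrictStructure 𝒜 π v) : Prop :=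
  ∀ (m : ℕ) (f : 𝒜.ring m) (x : Fin m → v.integer),
    τ.σ m f (fun i => algebraMap v.integer v'.integer (x i)) =
      algebraMap v.integer v'.integer (σ.σ m f x)

end Fields

end AnalyticStructure

/-! To evaluate `f` at a point of `K'`, each coordinate `x` is described by a monic equation `x^d +
∑ c_i x^i = 0` with `c_i ∈ K°`, and with `c_i ∈ K°°` when `x ∈ K'°°`. The `c_i` are treated as
values of fresh variables `t_i`. The generic polynomial `w = X_s^d + ∑ X_{t_i} X_s^i` is regular of
degree `d` in `X_s`, so Weierstrass division identifies the series in `X_s` and further variables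
`S` modulo `w` with polynomials in `X_s` over the series in `S` modulo `w`. A homomorphism on the
series in `S` whose values at the `X_{t_i}` are the `c_i` therefore extends uniquely to one with
`X_s ↦ x` (`exists_hom_insert`, `hom_ext_insert`). Starting from the evaluation by `σ` of the
coefficient variables and adding one variable at a time gives the value of `f` at any point of `K'`
(`IsFrame.exists_hom`).

Uniqueness of these extensions does the rest. Values obtained from different equations agree,
because both sets of coefficient variables can be made to coexist (`IsModel.eq_of_disjoint`,
`IsModel.eq`). Every structure extending `σ` yields the same homomorphisms, hence the same values
(`Extends.unique`).

The monic equations express that `K'°` is integral over `K°`, a form of henselianity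
(`exists_root`). Scale a minimal polynomial so that its last coefficient of maximal absolute value,
in degree `E`, becomes `1`. A generic polynomial of this shape is regular of degree `E`, so by
Weierstrass preparation it is a monic polynomial of degree `E` times a cofactor. Specializing gives
such a factorization over `K°`, and irreducibility forces `E` to be `0` or the full degree. The
coefficients above degree `E` must be values of generic topologically nilpotent elements: these are
the `ρ_j` in the separated case, and the `π ξ_i` in the strictly convergent case, where the prime
`π` generates `K°°`.

`WeierstrassAlgebra` records what both cases share. Taking the union over all numbers of variables
ensures that fresh variables never run out. -/

namespace AnalyticStructure

/-! ### Power series in a given set of variables, and polynomials in one further variable. -/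

section OnlyVars

variable {ι A : Type*} [CommRing A]

theorem OnlyVars.mono {S T : Set ι} (h : S ⊆ T) {f : MvPowerSeries ι A} (hf : OnlyVars S f) :
    OnlyVars T f :=
  fun α hα => (hf α hα).trans h

theorem OnlyVars.inter {S T : Set ι} {f : MvPowerSeries ι A} (hS : OnlyVars S f)
    (hT : OnlyVars T f) : OnlyVars (S ∩ T) f :=
  fun α hα => Set.subset_inter (hS α hα) (hT α hα)

/-- Reduces the question of which variables occur to one variable at a time, where it can be tested
by substituting `0`. -/
theorem OnlyVars.of_forall_compl {S : Set ι} {f : MvPowerSeries ι A}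
    (h : ∀ z ∉ S, OnlyVars {z}ᶜ f) : OnlyVars S f := by
  intro α hα z hz
  by_contra hzS
  exact h z hzS α hα hz rfl

theorem OnlyVars.compl_singleton {S : Set ι} {f : MvPowerSeries ι A} (h : OnlyVars S f) {z : ι}
    (hz : z ∉ S) : OnlyVars {z}ᶜ f :=
  by
  refine h.mono fun x hx => ?_
  rintro rfl
  exact hz hx

theorem onlyVars_X {S : Set ι} {s : ι} (hs : s ∈ S) :
    OnlyVars S (MvPowerSeries.X s : MvPowerSeries ι A) := by
  classical
  intro α hα
  rw [MvPowerSeries.coeff_X] at hα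
  have : α = Finsupp.single s 1 := by
    by_contra h
    exact hα (if_neg h)
  subst this
  intro x hx
  have := Finsupp.support_single_subset hx
  rw [Finset.mem_singleton] at this
  exact this ▸ hs

/-- The subalgebra `A[[S]]` of `A[[ι]]`. -/
noncomputable def onlyVarsSubalgebra (A : Type*) [CommRing A] {ι : Type*} (S : Set ι) :
    Subalgebra A (MvPowerSeries ι A) where
  carrier := {f | OnlyVars S f}
  mul_mem' := by
    classical
    intro f g hf hg α hα
    rw [MvPowerSeries.coeff_mul] at hα
    obtain ⟨⟨β, γ⟩, hmem, hne⟩ := Finset.exists_ne_zero_of_sum_ne_zero hα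
    rw [Finset.HasAntidiagonal.mem_antidiagonal] at hmem
    simp only at hmem hne
    subst hmem
    intro x hx
    rcases Finset.mem_union.1 (Finsupp.support_add hx) with h | h
    · exact hf β (left_ne_zero_of_mul hne) h
    · exact hg γ (right_ne_zero_of_mul hne) h
  add_mem' := by
    intro f g hf hg α hα
    rw [map_add] at hα
    by_cases h : MvPowerSeries.coeff α f = 0
    · rw [h, zero_add] at hα
      exact hg α hα
    · exact hf α h
  algebraMap_mem' := by
    classical
    intro a α hα
    rw [MvPowerSeries.algebraMap_apply, MvPowerSeries.coeff_C] at hα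
    have : α = 0 := by
      by_contra h
      exact hα (if_neg h)
    simp [this]

open Classical in
/-- The function underlying `setZero`. -/
noncomputable def setZeroFun (z : ι) (f : MvPowerSeries ι A) : MvPowerSeries ι A :=
  fun α => if α z = 0 then MvPowerSeries.coeff α f else 0

open Classical in
theorem coeff_setZeroFun (z : ι) (f : MvPowerSeries ι A) (α : ι →₀ ℕ) :
    MvPowerSeries.coeff α (setZeroFun z f) = if α z = 0 then MvPowerSeries.coeff α f else 0 := by
  rw [MvPowerSeries.coeff_apply, setZeroFun]

/-- The substitution of `0` for the variable `X_z`. -/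
noncomputable def setZero (A : Type*) [CommRing A] {ι : Type*} (z : ι) :
    MvPowerSeries ι A →+* MvPowerSeries ι A where
  toFun := setZeroFun z
  map_zero' := by
    ext α
    simp [coeff_setZeroFun]
  map_one' := by
    classical
    ext α
    simp only [coeff_setZeroFun, MvPowerSeries.coeff_one]
    by_cases h : α = 0 <;> simp [h]
  map_add' f g := by
    ext α
    simp only [coeff_setZeroFun, map_add]
    split_ifs <;> simp
  map_mul' f g := by
    classical
    ext α
    rw [MvPowerSeries.coeff_mul, coeff_setZeroFun]
    simp only [coeff_setZeroFun]
    split_ifs with h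
    · rw [MvPowerSeries.coeff_mul]
      refine Finset.sum_congr rfl fun p hp => ?_
      rw [Finset.HasAntidiagonal.mem_antidiagonal] at hp
      have := DFunLike.congr_fun hp z
      rw [Finsupp.add_apply, h] at this
      rw [if_pos (by omega), if_pos (by omega)]
    · symm
      refine Finset.sum_eq_zero fun p hp => ?_
      rw [Finset.HasAntidiagonal.mem_antidiagonal] at hp
      have := DFunLike.congr_fun hp z
      rw [Finsupp.add_apply] at this
      by_cases h1 : p.1 z = 0
      · rw [if_neg (c := p.2 z = 0) (by omega), mul_zero]
      · rw [if_neg h1, zero_mul]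

open Classical in
theorem coeff_setZero (z : ι) (f : MvPowerSeries ι A) (α : ι →₀ ℕ) :
    MvPowerSeries.coeff α (setZero A z f) = if α z = 0 then MvPowerSeries.coeff α f else 0 :=
  coeff_setZeroFun z f α

theorem setZero_of_onlyVars {z : ι} {f : MvPowerSeries ι A} (hf : OnlyVars {z}ᶜ f) :
    setZero A z f = f := by
  classical
  ext α
  rw [coeff_setZero]
  split_ifs with h
  · rfl
  · by_contra hne
    exact hf α (Ne.symm hne) (Finsupp.mem_support_iff.2 h) rfl

theorem onlyVars_setZero (z : ι) (f : MvPowerSeries ι A) : OnlyVars {z}ᶜ (setZero A z f) := by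
  classical
  rintro α hα x hx rfl
  rw [coeff_setZero] at hα
  exact hα (if_neg (Finsupp.mem_support_iff.1 hx))

theorem OnlyVars.setZero {S : Set ι} {f : MvPowerSeries ι A} (hf : OnlyVars S f) (z : ι) :
    OnlyVars S (setZero A z f) := by
  classical
  intro α hα
  rw [coeff_setZero] at hα
  by_cases h : α z = 0
  · rw [if_pos h] at hα
    exact hf α hα
  · exact absurd (if_neg h) hα

theorem setZero_X_self (z : ι) : setZero A z (MvPowerSeries.X z) = 0 := by
  classical
  ext α
  rw [coeff_setZero, MvPowerSeries.coeff_X]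
  by_cases h : α = Finsupp.single z 1 <;> simp [h]

/-- The coefficients do not involve `X_s`, so a monomial of exponent `i` in `X_s` can only come from
the term of degree `i`. Hence `X_s` is transcendental over such a ring `R`. -/
theorem coeff_aeval_X {s : ι} {R : Subalgebra A (MvPowerSeries ι A)}
    (hR : ∀ f ∈ R, OnlyVars {s}ᶜ f) (p : Polynomial R) (i : ℕ) (α : ι →₀ ℕ) (hα : α s = 0) :
    MvPowerSeries.coeff (α + Finsupp.single s i)
      (Polynomial.aeval (MvPowerSeries.X s : MvPowerSeries ι A) p) =
      MvPowerSeries.coeff α (p.coeff i : MvPowerSeries ι A) := by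
  classical
  have key : ∀ j, MvPowerSeries.coeff (α + Finsupp.single s i)
      (p.coeff j • (MvPowerSeries.X s : MvPowerSeries ι A) ^ j) =
      if j = i then MvPowerSeries.coeff α (p.coeff i : MvPowerSeries ι A) else 0 := by
    intro j
    rw [Subalgebra.smul_def, smul_eq_mul, MvPowerSeries.X_pow_eq,
      MvPowerSeries.coeff_mul_monomial, mul_one]
    split_ifs with h1 h2 h2
    · subst h2
      rw [add_tsub_cancel_right]
    · by_contra hne
      have := hR _ (p.coeff j).2 _ hne
      refine this (Finsupp.mem_support_iff.2 (?_ : _ ≠ 0)) rfl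
      have hle := h1 s
      simp only [Finsupp.single_eq_same, Finsupp.add_apply, hα, zero_add] at hle
      simp only [Finsupp.tsub_apply, Finsupp.add_apply, Finsupp.single_eq_same, hα]
      omega
    · subst h2
      exact absurd le_add_self h1
    · rfl
  rw [Polynomial.aeval_eq_sum_range, map_sum, Finset.sum_congr rfl fun j _ => key j,
    Finset.sum_ite_eq']
  split_ifs with h
  · rfl
  · rw [Polynomial.coeff_eq_zero_of_natDegree_lt (by simpa using h)]
    simp

theorem aeval_X_injective {s : ι} {R : Subalgebra A (MvPowerSeries ι A)}
    (hR : ∀ f ∈ R, OnlyVars {s}ᶜ f) :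
    Function.Injective (Polynomial.aeval (R := R) (MvPowerSeries.X s : MvPowerSeries ι A)) := by
  rw [injective_iff_map_eq_zero]
  intro p hp
  ext i α
  by_cases hα : α s = 0
  · rw [← coeff_aeval_X hR p i α hα, hp]
    simp
  · by_contra hne
    refine hR _ (p.coeff i).2 α ?_ (Finsupp.mem_support_iff.2 hα) rfl
    simpa using hne

theorem IsPolyOfDegreeLT.exists_polynomial {R : Subalgebra A (MvPowerSeries ι A)} {s : ι} {d : ℕ}
    {r : MvPowerSeries ι A} (h : IsPolyOfDegreeLT (R : Set (MvPowerSeries ι A)) s d r) :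
    ∃ p : Polynomial R, p.degree < d ∧ Polynomial.aeval (MvPowerSeries.X s) p = r := by
  obtain ⟨c, hc, rfl⟩ := h
  refine ⟨∑ i : Fin d, Polynomial.monomial (i : ℕ) ⟨c i, hc i i.2⟩, ?_, ?_⟩
  · refine (Polynomial.degree_sum_le _ _).trans_lt ?_
    refine (Finset.sup_lt_iff (WithBot.bot_lt_coe d)).2 fun i _ => ?_
    exact (Polynomial.degree_monomial_le _ _).trans_lt (WithBot.coe_lt_coe.2 i.2)
  · rw [map_sum, Finset.sum_range]
    refine Finset.sum_congr rfl fun i _ => ?_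
    rw [Polynomial.aeval_monomial]
    rfl

theorem isPolyOfDegreeLT_aeval {R : Subalgebra A (MvPowerSeries ι A)} {s : ι} {d : ℕ}
    {p : Polynomial R} (hp : p.degree < d) :
    IsPolyOfDegreeLT (R : Set (MvPowerSeries ι A)) s d (Polynomial.aeval (MvPowerSeries.X s) p) := by
  refine ⟨fun i => p.coeff i, fun i _ => (p.coeff i).2, ?_⟩
  rcases Nat.eq_zero_or_pos d with rfl | hd
  · have : p = 0 := Polynomial.degree_eq_bot.1 (by
      rw [← Nat.WithBot.lt_zero_iff]; exact_mod_cast hp)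
    simp [this]
  · have : p.natDegree < d := by
      by_cases h0 : p = 0
      · simpa [h0] using hd
      · exact (Polynomial.natDegree_lt_iff_degree_lt h0).2 hp
    rw [Polynomial.aeval_eq_sum_range' this]
    rfl

theorem sum_mul_X_pow_injective {s : ι} {d : ℕ} {c c' : ℕ → MvPowerSeries ι A}
    (hc : ∀ i < d, OnlyVars {s}ᶜ (c i)) (hc' : ∀ i < d, OnlyVars {s}ᶜ (c' i))
    (h : ∑ i ∈ Finset.range d, c i * MvPowerSeries.X s ^ i =
      ∑ i ∈ Finset.range d, c' i * MvPowerSeries.X s ^ i) : ∀ i < d, c i = c' i := by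
  intro i hi
  have key := aeval_X_injective (A := A) (s := s) (R := onlyVarsSubalgebra A {s}ᶜ)
    fun _ hf => hf
  have := @key (∑ i : Fin d, Polynomial.monomial (i : ℕ) ⟨c i, hc i i.2⟩)
    (∑ i : Fin d, Polynomial.monomial (i : ℕ) ⟨c' i, hc' i i.2⟩) (by
      simp only [map_sum, Polynomial.aeval_monomial]
      rw [Finset.sum_range, Finset.sum_range] at h
      exact h)
  have := congrArg (fun p : Polynomial (onlyVarsSubalgebra A {s}ᶜ) =>
    (p.coeff i : MvPowerSeries ι A)) this
  simp only [Polynomial.finsetSum_coeff, Polynomial.coeff_monomial] at this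
  rw [Finset.sum_eq_single ⟨i, hi⟩, Finset.sum_eq_single ⟨i, hi⟩] at this
  · simpa using this
  all_goals simp +contextual [Fin.ext_iff]

end OnlyVars

end AnalyticStructure

/-! ### Weierstrass division inside a set of variables, and extension of homomorphisms by one
variable. -/

namespace AnalyticStructure

section WeierstrassAlgebra

variable {ι A : Type*} [CommRing A]

/-- Unique Weierstrass division by `f`, with remainder of degree less than `d` in `X_s`. -/
def HasDivision (B : Subalgebra A (MvPowerSeries ι A)) (s : ι) (d : ℕ)
    (f : MvPowerSeries ι A) : Prop :=
  ∀ g ∈ B, ∃! qr : MvPowerSeries ι A × MvPowerSeries ι A, qr.1 ∈ B ∧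
    IsPolyOfDegreeLT {a | a ∈ B ∧ OnlyVars {s}ᶜ a} s d qr.2 ∧ g = qr.1 * f + qr.2

variable (ι A) in
/-- An algebra of power series in infinitely many variables with Weierstrass division. The variables
from `small` are those restricted to the open disc, `nil` is the ideal of topologically nilpotent
series, and the elements `e X_t`, `t ∈ Z`, of `nil` serve as generic coefficients of small
absolute value. -/
structure WeierstrassAlgebra where
  B : Subalgebra A (MvPowerSeries ι A)
  small : Set ι
  nil : Ideal (MvPowerSeries ι A)
  e : A
  Z : Set ι
  X_mem : ∀ s, MvPowerSeries.X s ∈ B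
  exists_finset : ∀ f ∈ B, ∃ T : Finset ι, OnlyVars T f
  infinite_kind : ∀ s, {t | t ∈ small ↔ s ∈ small}.Infinite
  exists_not_small : ∃ s, s ∉ small
  infinite_Z : Z.Infinite
  e_mul_X_mem : ∀ t ∈ Z, algebraMap A _ e * MvPowerSeries.X t ∈ nil
  division_xi : ∀ s ∉ small, ∀ d (c : ℕ → MvPowerSeries ι A) h,
    (∀ i < d, c i ∈ B ∧ OnlyVars {s}ᶜ (c i)) → h ∈ B → h ∈ nil →
    HasDivision B s d
      (MvPowerSeries.X s ^ d + ∑ i ∈ Finset.range d, c i * MvPowerSeries.X s ^ i + h)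
  division_rho : ∀ s ∈ small, ∀ d (c : ℕ → MvPowerSeries ι A),
    (∀ i < d, c i = 0 ∨ ∃ t ∈ small, t ≠ s ∧ c i = MvPowerSeries.X t) →
    HasDivision B s d
      (MvPowerSeries.X s ^ d + ∑ i ∈ Finset.range d, c i * MvPowerSeries.X s ^ i)

namespace WeierstrassAlgebra

variable (W : WeierstrassAlgebra ι A)

/-- The series in `W` in the variables from `U`. -/
noncomputable def on (U : Set ι) : Subalgebra A (MvPowerSeries ι A) :=
  W.B ⊓ onlyVarsSubalgebra A U

variable {W}

theorem mem_on {U : Set ι} {f : MvPowerSeries ι A} : f ∈ W.on U ↔ f ∈ W.B ∧ OnlyVars U f :=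
  Iff.rfl

theorem on_mono {U V : Set ι} (h : U ⊆ V) : W.on U ≤ W.on V :=
  fun _ hf => ⟨hf.1, hf.2.mono h⟩

theorem X_mem_on {U : Set ι} {s : ι} (hs : s ∈ U) : MvPowerSeries.X s ∈ W.on U :=
  ⟨W.X_mem s, onlyVars_X hs⟩

theorem hasDivision_X (s : ι) : HasDivision W.B s 1 (MvPowerSeries.X s) := by
  by_cases hs : s ∈ W.small
  · have := W.division_rho s hs 1 (fun _ => 0) (fun _ _ => Or.inl rfl)
    simpa using this
  · have := W.division_xi s hs 1 (fun _ => 0) 0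
      (fun _ _ => ⟨zero_mem _, (onlyVarsSubalgebra A _).zero_mem⟩) (zero_mem _) (zero_mem _)
    simpa using this

/-- Substituting `0` for `X_z` amounts to taking the remainder of division by `X_z`, and remainders
stay in the algebra. -/
theorem setZero_mem {f : MvPowerSeries ι A} (hf : f ∈ W.B) (z : ι) : setZero A z f ∈ W.B := by
  obtain ⟨⟨q, r⟩, ⟨-, ⟨c, hc, hr⟩, hfr⟩, -⟩ := hasDivision_X (W := W) z f hf
  simp only [Finset.range_one, Finset.sum_singleton, pow_zero, mul_one] at hr
  simp only at hfr
  obtain ⟨h1, h2⟩ := hc 0 one_pos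
  rw [hfr, map_add, map_mul, setZero_X_self, mul_zero, zero_add, hr, setZero_of_onlyVars h2]
  exact h1

/-- By uniqueness, quotient and remainder involve no variables other than those of the dividend and
the divisor. -/
theorem exists_division_on {s : ι} {d : ℕ} {w : MvPowerSeries ι A} (hw : HasDivision W.B s d w)
    {S U : Set ι} (hU : U = insert s S) (hwU : OnlyVars U w)
    {f : MvPowerSeries ι A} (hf : f ∈ W.on U) :
    ∃ q ∈ W.on U, ∃ r, IsPolyOfDegreeLT (W.on S : Set (MvPowerSeries ι A)) s d r ∧
      f = q * w + r := by
  obtain ⟨⟨q, r⟩, ⟨hq, ⟨c, hc, hr⟩, hfr⟩, huniq⟩ := hw f hf.1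
  simp only at hq hr hfr
  have key : ∀ z ∉ U, setZero A z q = q ∧ setZero A z r = r := by
    intro z hz
    have hzs : s ≠ z := by
      rintro rfl
      exact hz (hU ▸ Set.mem_insert _ _)
    have hr' : setZero A z r =
        ∑ i ∈ Finset.range d, setZero A z (c i) * MvPowerSeries.X s ^ i := by
      rw [hr, map_sum]
      refine Finset.sum_congr rfl fun i _ => ?_
      rw [map_mul, map_pow, setZero_of_onlyVars (f := MvPowerSeries.X s)]
      exact onlyVars_X hzs
    have := huniq (setZero A z q, setZero A z r) ⟨setZero_mem hq z,
      ⟨fun i => setZero A z (c i), fun i hi => ⟨setZero_mem (hc i hi).1 z, (hc i hi).2.setZero z⟩,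
        hr'⟩, ?_⟩
    · exact ⟨congrArg Prod.fst this, congrArg Prod.snd this⟩
    · have h1 := congrArg (setZero A z) hfr
      rwa [map_add, map_mul, setZero_of_onlyVars (hf.2.compl_singleton hz),
        setZero_of_onlyVars (hwU.compl_singleton hz)] at h1
  refine ⟨q, ⟨hq, OnlyVars.of_forall_compl fun z hz => ?_⟩, r, ⟨c, fun i hi => ⟨(hc i hi).1, ?_⟩, hr⟩,
    hfr⟩
  · rw [← (key z hz).1]
    exact onlyVars_setZero z q
  · refine OnlyVars.of_forall_compl fun z hz => ?_
    by_cases hzs : z = s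
    · exact hzs ▸ (hc i hi).2
    have hzU : z ∉ U := by
      rw [hU]
      simp [hzs, hz]
    have h1 := (key z hzU).2
    rw [hr, map_sum] at h1
    -- The remainder is fixed by `X_z = 0`. Comparing coefficients of powers of `X_s` shows that
    -- each `c i` is fixed too.
    have h2 := sum_mul_X_pow_injective (c := fun i => setZero A z (c i)) (c' := c) (s := s) (d := d)
      (fun i hi => (hc i hi).2.setZero z) (fun i hi => (hc i hi).2) (by
        rw [← h1]
        refine Finset.sum_congr rfl fun i _ => ?_
        rw [map_mul, map_pow, setZero_of_onlyVars (f := MvPowerSeries.X s)]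
        exact onlyVars_X (Ne.symm hzs)) i hi
    rw [← h2]
    exact onlyVars_setZero z _

/-- Modulo `w`, every series is a polynomial in `X_s` with coefficients in the variables `S`. -/
theorem hom_ext_insert {L : Type*} [CommRing L] {s : ι} {d : ℕ} {w : MvPowerSeries ι A}
    (hw : HasDivision W.B s d w) {S U : Set ι} (hU : U = insert s S)
    (hwU : w ∈ W.on U) {ψ ψ' : W.on U →+* L}
    (hψ : ψ ⟨w, hwU⟩ = 0) (hψ' : ψ' ⟨w, hwU⟩ = 0)
    (hX : ∀ h, ψ ⟨MvPowerSeries.X s, h⟩ = ψ' ⟨MvPowerSeries.X s, h⟩)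
    (hS : ∀ f ∈ W.on S, ∀ h, ψ ⟨f, h⟩ = ψ' ⟨f, h⟩) : ψ = ψ' := by
  have hSU : S ⊆ U := hU ▸ Set.subset_insert _ _
  have hsU : s ∈ U := hU ▸ Set.mem_insert _ _
  refine RingHom.ext fun ⟨f, hf⟩ => ?_
  obtain ⟨q, hq, r, ⟨c, hc, rfl⟩, rfl⟩ := exists_division_on hw hU hwU.2 hf
  have : (⟨q * w + ∑ i ∈ Finset.range d, c i * MvPowerSeries.X s ^ i, hf⟩ : W.on U) =
      ⟨q, hq⟩ * ⟨w, hwU⟩ + ∑ i : Fin d, ⟨c i, on_mono hSU (hc i i.2)⟩ *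
        ⟨MvPowerSeries.X s, X_mem_on hsU⟩ ^ (i : ℕ) := by
    ext1
    simp [Finset.sum_range]
  rw [this]
  simp only [map_add, map_mul, map_sum, map_pow, hψ, hψ', mul_zero, hX]
  congr 1
  exact Finset.sum_congr rfl fun i _ => by rw [hS _ (hc i i.2)]

/-- The first hypothesis makes `P → R/(w)` surjective and the second says that `χ` kills its kernel.
So `χ` descends to `R/(w)`. -/
theorem exists_hom_of_forall_eq_add {P R L : Type*} [CommRing P] [CommRing R] [CommRing L]
    (j : P →+* R) (w : R) (χ : P →+* L) (hj : ∀ f, ∃ q p, f = q * w + j p)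
    (hχ : ∀ q p, j p = q * w → χ p = 0) : ∃ ψ : R →+* L, ∀ p, ψ (j p) = χ p := by
  have hg : Function.Surjective ((Ideal.Quotient.mk (Ideal.span {w})).comp j) := by
    intro y
    obtain ⟨f, rfl⟩ := Ideal.Quotient.mk_surjective y
    obtain ⟨q, p, rfl⟩ := hj f
    refine ⟨p, Eq.symm (Ideal.Quotient.eq.2 (Ideal.mem_span_singleton'.2 ⟨q, ?_⟩))⟩
    rw [add_sub_cancel_right]
  have hker : RingHom.ker ((Ideal.Quotient.mk (Ideal.span {w})).comp j) ≤ RingHom.ker χ := by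
    intro p hp
    obtain ⟨q, hq⟩ := Ideal.mem_span_singleton'.1 (Ideal.Quotient.eq_zero_iff_mem.1 hp)
    exact hχ q p hq.symm
  exact ⟨(RingHom.liftOfSurjective _ hg ⟨χ, hker⟩).comp (Ideal.Quotient.mk _), fun p =>
    RingHom.liftOfRightInverse_comp_apply _ _ (Function.rightInverse_surjInv hg) ⟨χ, hker⟩ p⟩

/-- Existence of division shows that polynomials in `X_s` fill up the series modulo `P`. Uniqueness
shows that a polynomial divisible by `P` as a series is divisible by `P` as a polynomial, and hence
vanishes at the root `x`. -/
theorem exists_hom_insert {L : Type*} [CommRing L] {s : ι} {S U : Set ι} (hs : s ∉ S)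
    (hU : U = insert s S) {P : Polynomial (W.on S)} (hP : P.Monic)
    (hw : HasDivision W.B s P.natDegree (Polynomial.aeval (MvPowerSeries.X s) P))
    (φ : W.on S →+* L) {x : L} (hx : P.eval₂ φ x = 0) :
    ∃ ψ : W.on U →+* L, (∀ h, ψ ⟨MvPowerSeries.X s, h⟩ = x) ∧
      ∀ f, ∀ h : f ∈ W.on S, ∀ h', ψ ⟨f, h'⟩ = φ ⟨f, h⟩ := by
  have hSU : S ⊆ U := hU ▸ Set.subset_insert _ _
  have hsU : s ∈ U := hU ▸ Set.mem_insert _ _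
  have hj : ∀ p : Polynomial (W.on S),
      Polynomial.aeval (MvPowerSeries.X s : MvPowerSeries ι A) p ∈ W.on U := by
    intro p
    rw [Polynomial.aeval_eq_sum_range]
    exact sum_mem fun i _ => mul_mem (on_mono hSU (p.coeff i).2) (pow_mem (X_mem_on hsU) i)
  obtain ⟨j, hjp⟩ : ∃ j : Polynomial (W.on S) →+* W.on U,
      ∀ p, (j p : MvPowerSeries ι A) = Polynomial.aeval (MvPowerSeries.X s) p :=
    ⟨(Polynomial.aeval (MvPowerSeries.X s : MvPowerSeries ι A)).toRingHom.codRestrict (W.on U) hj,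
      fun _ => rfl⟩
  have hsurj : ∀ f, ∃ q p, f = q * j P + j p := by
    rintro ⟨f, hf⟩
    obtain ⟨q, hq, r, hr, hfr⟩ := exists_division_on hw hU (hj P).2 hf
    obtain ⟨p, -, rfl⟩ := hr.exists_polynomial
    refine ⟨⟨q, hq⟩, p, Subtype.ext ?_⟩
    rw [AddMemClass.coe_add, MulMemClass.coe_mul, hjp, hjp]
    exact hfr
  have hker : ∀ q p, j p = q * j P → Polynomial.eval₂RingHom φ x p = 0 := by
    rintro ⟨q, hq⟩ p hqp
    replace hqp := (congrArg Subtype.val hqp).symm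
    rw [MulMemClass.coe_mul, hjp, hjp] at hqp
    have hdiv := Polynomial.modByMonic_add_div p P
    rcases subsingleton_or_nontrivial (W.on S) with _ | _
    · rw [Subsingleton.elim p 0, map_zero]
    have hdeg : (p %ₘ P).degree < (P.natDegree : ℕ) := by
      rw [← Polynomial.degree_eq_natDegree hP.ne_zero]
      exact Polynomial.degree_modByMonic_lt p hP
    have hmem := isPolyOfDegreeLT_aeval (s := s) hdeg
    have hset : (W.on S : Set (MvPowerSeries ι A)) ⊆ {a | a ∈ W.B ∧ OnlyVars {s}ᶜ a} :=
      fun f hf => ⟨hf.1, hf.2.compl_singleton hs⟩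
    have hmem' : IsPolyOfDegreeLT {a | a ∈ W.B ∧ OnlyVars {s}ᶜ a} s P.natDegree
        (Polynomial.aeval (MvPowerSeries.X s : MvPowerSeries ι A) (p %ₘ P)) := by
      obtain ⟨c, hc, h⟩ := hmem
      exact ⟨c, fun i hi => hset (hc i hi), h⟩
    have hzero : IsPolyOfDegreeLT {a | a ∈ W.B ∧ OnlyVars {s}ᶜ a} s P.natDegree
        (0 : MvPowerSeries ι A) :=
      ⟨0, fun _ _ => ⟨zero_mem _, (onlyVarsSubalgebra A _).zero_mem⟩, by simp⟩
    -- The series of `p %ₘ P` has two divisions by `P`: the one with quotient `0`, and an exact one,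
    -- because `p` is a multiple of `P` as a series.
    have h1 := (hw _ (hj (p %ₘ P)).1).unique
      (y₁ := (0, Polynomial.aeval (MvPowerSeries.X s) (p %ₘ P)))
      (y₂ := (q - Polynomial.aeval (MvPowerSeries.X s) (p /ₘ P), 0))
      ⟨zero_mem _, hmem', by simp⟩
      ⟨sub_mem hq.1 (hj _).1, hzero, by
        have := congrArg (Polynomial.aeval (MvPowerSeries.X s : MvPowerSeries ι A)) hdiv
        rw [map_add, map_mul] at this
        simp only
        rw [add_zero, sub_mul, hqp, ← this]
        ring⟩
    have h2 : Polynomial.aeval (MvPowerSeries.X s : MvPowerSeries ι A) (p %ₘ P) = 0 :=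
      congrArg Prod.snd h1
    have h3 : p %ₘ P = 0 :=
      aeval_X_injective (fun f hf => (hset hf).2) (h2.trans (map_zero _).symm)
    rw [← hdiv, h3, zero_add, map_mul]
    simp only [Polynomial.coe_eval₂RingHom, hx, zero_mul]
  obtain ⟨ψ, hψ⟩ := exists_hom_of_forall_eq_add (P := Polynomial (W.on S)) (R := W.on U) j (j P)
    (Polynomial.eval₂RingHom φ x) hsurj hker
  refine ⟨ψ, fun h => ?_, fun f h h' => ?_⟩
  · have : (⟨MvPowerSeries.X s, h⟩ : W.on U) = j Polynomial.X :=
      Subtype.ext (by rw [hjp, Polynomial.aeval_X])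
    rw [this, hψ, Polynomial.coe_eval₂RingHom, Polynomial.eval₂_X]
  · have : (⟨f, h'⟩ : W.on U) = j (Polynomial.C ⟨f, h⟩) :=
      Subtype.ext (by rw [hjp, Polynomial.aeval_C, Subalgebra.algebraMap_def,
        Algebra.algebraMap_self, RingHom.id_apply])
    rw [this, hψ, Polynomial.coe_eval₂RingHom, Polynomial.eval₂_C]

end WeierstrassAlgebra

end WeierstrassAlgebra

end AnalyticStructure

/-! ### Adjoining roots of generic monic polynomials. -/

namespace AnalyticStructure

namespace WeierstrassAlgebra

variable {ι A : Type*} [CommRing A] {W : WeierstrassAlgebra ι A} {L : Type*} [CommRing L]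

/-- The monic polynomial of degree `d` in `X_s` whose coefficients are the variables `X_{t i}`. -/
noncomputable def genericPoly (A : Type*) [CommRing A] {ι : Type*} (s : ι) (d : ℕ) (t : ℕ → ι) :
    MvPowerSeries ι A :=
  MvPowerSeries.X s ^ d +
    ∑ i ∈ Finset.range d, MvPowerSeries.X (t i) * MvPowerSeries.X s ^ i

/-- In an open-disc variable, regularity of degree `d` requires the lower coefficients to be
topologically nilpotent, whence the condition on the `t i`. In a closed-disc variable a monic
polynomial is always regular. -/
theorem hasDivision_genericPoly {s : ι} {d : ℕ} {t : ℕ → ι}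
    (ht : ∀ i < d, t i ≠ s ∧ (s ∈ W.small → t i ∈ W.small)) :
    HasDivision W.B s d (genericPoly A s d t) := by
  by_cases hs : s ∈ W.small
  · exact W.division_rho s hs d _ fun i hi => Or.inr ⟨t i, (ht i hi).2 hs, (ht i hi).1, rfl⟩
  · have := W.division_xi s hs d (fun i => MvPowerSeries.X (t i)) 0
      (fun i hi => ⟨W.X_mem _, onlyVars_X (ht i hi).1⟩) (zero_mem _) (zero_mem _)
    rwa [add_zero] at this

theorem genericPoly_mem {s : ι} {d : ℕ} {t : ℕ → ι} {U : Set ι} (hs : s ∈ U)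
    (ht : ∀ i < d, t i ∈ U) : genericPoly A s d t ∈ W.on U :=
  add_mem (pow_mem (X_mem_on hs) _) (sum_mem fun i hi =>
    mul_mem (X_mem_on (ht i (Finset.mem_range.1 hi))) (pow_mem (X_mem_on hs) _))

theorem map_genericPoly {s : ι} {d : ℕ} {t : ℕ → ι} {U : Set ι} (hs : s ∈ U)
    (ht : ∀ i < d, t i ∈ U) (ψ : W.on U →+* L) {a : ι → L} {x : L}
    (ha : ∀ i (hi : i < d), ψ ⟨MvPowerSeries.X (t i), X_mem_on (ht i hi)⟩ = a (t i))
    (hx : ψ ⟨MvPowerSeries.X s, X_mem_on hs⟩ = x) :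
    ψ ⟨genericPoly A s d t, genericPoly_mem hs ht⟩ =
      x ^ d + ∑ i ∈ Finset.range d, a (t i) * x ^ i := by
  have : (⟨genericPoly A s d t, genericPoly_mem hs ht⟩ : W.on U) =
      ⟨MvPowerSeries.X s, X_mem_on hs⟩ ^ d + ∑ i : Fin d,
        ⟨MvPowerSeries.X (t i), X_mem_on (ht i i.2)⟩ *
          ⟨MvPowerSeries.X s, X_mem_on hs⟩ ^ (i : ℕ) := by
    ext1
    simp [genericPoly, Finset.sum_range]
  rw [this, map_add, map_pow, hx, map_sum, Finset.sum_range]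
  congr 1
  refine Finset.sum_congr rfl fun i _ => ?_
  rw [map_mul, map_pow, hx, ha i i.2]

theorem exists_monic_of_coeffs {R : Type*} [CommRing R] (d : ℕ) (c : Fin d → R) :
    ∃ P : Polynomial R, P.Monic ∧ (Nontrivial R → P.natDegree = d) ∧
      P = Polynomial.X ^ d + ∑ i : Fin d, Polynomial.C (c i) * Polynomial.X ^ (i : ℕ) := by
  have hdeg : (∑ i : Fin d, Polynomial.C (c i) * Polynomial.X ^ (i : ℕ)).degree < (d : WithBot ℕ) :=
    Polynomial.degree_sum_fin_lt c
  refine ⟨_, Polynomial.monic_X_pow_add hdeg, fun _ => ?_, rfl⟩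
  refine Polynomial.natDegree_eq_of_degree_eq_some ?_
  rw [Polynomial.degree_add_eq_left_of_degree_lt, Polynomial.degree_X_pow]
  rwa [Polynomial.degree_X_pow]

/-- The values `x s`, `s ∈ T`, are roots of monic polynomials whose coefficients are the values `a t`
of variables `t ∈ F`. -/
structure IsFrame (W : WeierstrassAlgebra ι A) (T F : Finset ι) (a x : ι → L) : Prop where
  notMem : ∀ s ∈ T, s ∉ F
  root : ∀ s ∈ T, ∃ (d : ℕ) (t : ℕ → ι), (∀ i < d, t i ∈ F ∧ (s ∈ W.small → t i ∈ W.small)) ∧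
    x s ^ d + ∑ i ∈ Finset.range d, a (t i) * x s ^ i = 0

theorem IsFrame.mono {T T' F F' : Finset ι} {a a' x x' : ι → L} (h : W.IsFrame T F a x)
    (hT : T' ⊆ T) (hF : F ⊆ F') (hF' : ∀ s ∈ T', s ∉ F') (ha : ∀ t ∈ F, a' t = a t)
    (hx : ∀ s ∈ T', x' s = x s) : W.IsFrame T' F' a' x' where
  notMem := hF'
  root s hs := by
    obtain ⟨d, t, ht, hroot⟩ := h.root s (hT hs)
    refine ⟨d, t, fun i hi => ⟨hF (ht i hi).1, (ht i hi).2⟩, ?_⟩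
    rw [hx s hs, ← hroot]
    congr 1
    exact Finset.sum_congr rfl fun i hi => by rw [ha _ (ht i (Finset.mem_range.1 hi)).1]

/-- The variables of `T` are adjoined one by one. Their equations have coefficients in `F`, which is
disjoint from `T`, so each equation is already available whatever the order. -/
theorem IsFrame.exists_hom {F : Finset ι} {a x : ι → L} (φ : W.on F →+* L)
    (hφ : ∀ t ∈ F, ∀ h, φ ⟨MvPowerSeries.X t, h⟩ = a t) (T : Finset ι) (h : W.IsFrame T F a x) :
    ∀ U : Set ι, U = ↑F ∪ ↑T → ∃ ψ : W.on U →+* L,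
      (∀ s ∈ T, ∀ h, ψ ⟨MvPowerSeries.X s, h⟩ = x s) ∧
      ∀ f, ∀ h : f ∈ W.on F, ∀ h', ψ ⟨f, h'⟩ = φ ⟨f, h⟩ := by
  classical
  induction T using Finset.induction_on with
  | empty =>
    intro U hU
    have : U = ↑F := by simp [hU]
    subst this
    exact ⟨φ, by simp, fun _ _ _ => rfl⟩
  | insert s T hsT ih =>
    intro U hU
    obtain ⟨ψ₀, hψX, hψF⟩ := ih (h.mono (Finset.subset_insert _ _) subset_rfl
      (fun z hz => h.notMem z (Finset.mem_insert_of_mem hz)) (fun _ _ => rfl) fun _ _ => rfl) _ rfl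
    obtain ⟨d, t, ht, hroot⟩ := h.root s (Finset.mem_insert_self s T)
    have hsF := h.notMem s (Finset.mem_insert_self s T)
    have hsS : s ∉ (↑F ∪ ↑T : Set ι) := by simp [hsF, hsT]
    have hUS : U = insert s (↑F ∪ ↑T : Set ι) := by
      rw [hU, Finset.coe_insert, Set.union_insert]
    have htS : ∀ i < d, t i ∈ (↑F ∪ ↑T : Set ι) := fun i hi => Or.inl (ht i hi).1
    have hdiv : HasDivision W.B s d (genericPoly A s d t) := by
      refine hasDivision_genericPoly fun i hi => ⟨?_, (ht i hi).2⟩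
      rintro heq
      exact hsF (heq ▸ (ht i hi).1)
    have ha : ∀ i (hi : i < d), ψ₀ ⟨MvPowerSeries.X (t i), X_mem_on (htS i hi)⟩ = a (t i) :=
      fun i hi => (hψF _ (X_mem_on (ht i hi).1) _).trans (hφ _ (ht i hi).1 _)
    obtain ⟨P, hP, hPd, hPeq⟩ := exists_monic_of_coeffs (R := W.on (↑F ∪ ↑T : Set ι)) d
      fun i => ⟨MvPowerSeries.X (t i), X_mem_on (htS i i.2)⟩
    have hPw : Polynomial.aeval (MvPowerSeries.X s) P = genericPoly A s d t := by
      rw [hPeq, genericPoly, map_add, map_pow, Polynomial.aeval_X, map_sum, Finset.sum_range]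
      congr 1
      refine Finset.sum_congr rfl fun i _ => ?_
      rw [map_mul, map_pow, Polynomial.aeval_X, Polynomial.aeval_C]
      rfl
    have hPx : P.eval₂ ψ₀ (x s) = 0 := by
      rw [hPeq, Polynomial.eval₂_add, Polynomial.eval₂_pow, Polynomial.eval₂_X,
        Polynomial.eval₂_finsetSum, ← hroot, Finset.sum_range]
      congr 1
      refine Finset.sum_congr rfl fun i _ => ?_
      rw [Polynomial.eval₂_mul, Polynomial.eval₂_pow, Polynomial.eval₂_X, Polynomial.eval₂_C,
        ha i i.2]
    -- Over the zero ring `P` need not have `natDegree` equal to `d`. In that case `L` is also zero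
    -- and any homomorphism will do.
    rcases subsingleton_or_nontrivial (W.on (↑F ∪ ↑T : Set ι)) with hsub | hnon
    · have : Subsingleton L := by
        have h01 := congrArg ψ₀ (Subsingleton.elim (0 : W.on (↑F ∪ ↑T : Set ι)) 1)
        rw [map_zero, map_one] at h01
        exact subsingleton_of_zero_eq_one h01
      have hA : Subsingleton (MvPowerSeries ι A) := by
        have h01 := congrArg Subtype.val (Subsingleton.elim (0 : W.on (↑F ∪ ↑T : Set ι)) 1)
        exact subsingleton_of_zero_eq_one h01
      exact ⟨ψ₀.comp (Subalgebra.inclusion fun f _ => by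
          rw [Subsingleton.elim f 0]; exact zero_mem _).toRingHom,
        fun _ _ _ => Subsingleton.elim _ _, fun _ _ _ => Subsingleton.elim _ _⟩
    obtain ⟨ψ, hψs, hψS⟩ := exists_hom_insert hsS hUS hP
      (by rw [hPw, hPd hnon]; exact hdiv) ψ₀ hPx
    refine ⟨ψ, fun z hz hz' => ?_, fun f hf hf' => ?_⟩
    · rcases Finset.mem_insert.1 hz with rfl | hz
      · exact hψs _
      · have hmem : MvPowerSeries.X z ∈ W.on (↑F ∪ ↑T : Set ι) := X_mem_on (Or.inr hz)
        exact (hψS _ hmem _).trans (hψX z hz _)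
    · have hmem : f ∈ W.on (↑F ∪ ↑T : Set ι) := on_mono Set.subset_union_left hf
      exact (hψS _ hmem _).trans (hψF _ hf _)

theorem IsFrame.hom_ext {F : Finset ι} {a x : ι → L} (T : Finset ι) (h : W.IsFrame T F a x)
    {U : Set ι} (hU : U = ↑F ∪ ↑T) {ψ ψ' : W.on U →+* L}
    (hF : ∀ t ∈ F, ∀ h, ψ ⟨MvPowerSeries.X t, h⟩ = a t)
    (hψ : ∀ s ∈ T, ∀ h, ψ ⟨MvPowerSeries.X s, h⟩ = x s)
    (hψ' : ∀ s ∈ T, ∀ h, ψ' ⟨MvPowerSeries.X s, h⟩ = x s)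
    (hFF : ∀ f ∈ W.on F, ∀ h, ψ ⟨f, h⟩ = ψ' ⟨f, h⟩) : ψ = ψ' := by
  classical
  induction T using Finset.induction_on generalizing U with
  | empty =>
    have : U = ↑F := by simp [hU]
    subst this
    exact RingHom.ext fun f => hFF f f.2 f.2
  | insert s T hsT ih =>
    obtain ⟨d, t, ht, hroot⟩ := h.root s (Finset.mem_insert_self s T)
    have hsF := h.notMem s (Finset.mem_insert_self s T)
    have hUS : U = insert s (↑F ∪ ↑T : Set ι) := by
      rw [hU, Finset.coe_insert, Set.union_insert]
    have hsU : s ∈ U := hUS ▸ Set.mem_insert _ _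
    have hSU : (↑F ∪ ↑T : Set ι) ⊆ U := hUS ▸ Set.subset_insert _ _
    have htU : ∀ i < d, t i ∈ U := fun i hi => hSU (Or.inl (ht i hi).1)
    have hdiv : HasDivision W.B s d (genericPoly A s d t) := by
      refine hasDivision_genericPoly fun i hi => ⟨?_, (ht i hi).2⟩
      rintro heq
      exact hsF (heq ▸ (ht i hi).1)
    have hs := Finset.mem_insert_self s T
    have key := ih (h.mono (Finset.subset_insert _ _) subset_rfl
      (fun z hz => h.notMem z (Finset.mem_insert_of_mem hz)) (fun _ _ => rfl) fun _ _ => rfl) rfl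
      (ψ := ψ.comp (Subalgebra.inclusion (on_mono hSU)).toRingHom)
      (ψ' := ψ'.comp (Subalgebra.inclusion (on_mono hSU)).toRingHom)
      (fun z hz _ => hF z hz _)
      (fun z hz _ => hψ z (Finset.mem_insert_of_mem hz) _)
      (fun z hz _ => hψ' z (Finset.mem_insert_of_mem hz) _)
      (fun f hf _ => hFF f hf _)
    refine hom_ext_insert hdiv hUS (genericPoly_mem hsU htU) ?_ ?_
      (fun hX => (hψ s hs hX).trans (hψ' s hs hX).symm)
      fun f hf _ => DFunLike.congr_fun key ⟨f, hf⟩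
    · rw [map_genericPoly hsU htU ψ (fun i hi => hF _ (ht i hi).1 _) (hψ s hs _), hroot]
    · rw [map_genericPoly hsU htU ψ' (fun i hi => (hFF _ (X_mem_on (ht i hi).1) _).symm.trans
        (hF _ (ht i hi).1 _)) (hψ' s hs _), hroot]

end WeierstrassAlgebra

end AnalyticStructure

/-! ### Fresh variables, and factorization of polynomials over the valuation ring by Weierstrass
preparation. -/

namespace AnalyticStructure

/-- Supplies distinct fresh variables of prescribed kinds, outside the finite set `G` of variables
already in use. -/
theorem exists_injOn_mem {κ ι : Type*} [Nonempty ι] (J : Finset κ) (S : κ → Set ι)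
    (hS : ∀ k ∈ J, (S k).Infinite) (G : Finset ι) :
    ∃ t : κ → ι, Set.InjOn t J ∧ ∀ k ∈ J, t k ∈ S k ∧ t k ∉ G := by
  classical
  induction J using Finset.induction_on with
  | empty => exact ⟨fun _ => Classical.arbitrary ι, by simp, by simp⟩
  | insert j J hj ih =>
    obtain ⟨t, hinj, ht⟩ := ih fun k hk => hS k (Finset.mem_insert_of_mem hk)
    obtain ⟨z, hz, hzG⟩ := (hS j (Finset.mem_insert_self j J)).exists_notMem_finset (G ∪ J.image t)
    rw [Finset.mem_union, not_or] at hzG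
    have hne : ∀ k ∈ J, k ≠ j := fun k hk h => hj (h ▸ hk)
    have hzt : ∀ k ∈ J, t k ≠ z := fun k hk h => hzG.2 (Finset.mem_image.2 ⟨k, hk, h⟩)
    refine ⟨Function.update t j z, ?_, ?_⟩
    · intro a ha b hb hab
      rw [Finset.mem_coe, Finset.mem_insert] at ha hb
      rcases ha with rfl | ha <;> rcases hb with rfl | hb
      · rfl
      · rw [Function.update_self, Function.update_of_ne (hne b hb)] at hab
        exact absurd hab.symm (hzt b hb)
      · rw [Function.update_self, Function.update_of_ne (hne a ha)] at hab
        exact absurd hab (hzt a ha)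
      · rw [Function.update_of_ne (hne a ha), Function.update_of_ne (hne b hb)] at hab
        exact hinj ha hb hab
    · intro k hk
      rcases Finset.mem_insert.1 hk with rfl | hk
      · rw [Function.update_self]
        exact ⟨hz, hzG.1⟩
      · rw [Function.update_of_ne (hne k hk)]
        exact ht k hk

/-- Gives fresh variables their values. The default `0` lies in both discs, so the result can serve
as a point. -/
theorem exists_fun_of_injOn {κ ι R : Type*} [Zero R] {J : Finset κ} {t : κ → ι}
    (ht : Set.InjOn t J) (x : κ → R) :
    ∃ p : ι → R, (∀ k ∈ J, p (t k) = x k) ∧ ∀ z, p z = 0 ∨ ∃ k ∈ J, t k = z ∧ p z = x k := by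
  classical
  let p : ι → R := fun z => if h : ∃ k ∈ J, t k = z then x h.choose else 0
  have hp : ∀ k ∈ J, p (t k) = x k := by
    intro k hk
    have h : ∃ k' ∈ J, t k' = t k := ⟨k, hk, rfl⟩
    have : p (t k) = x h.choose := dif_pos h
    rw [this, ht h.choose_spec.1 hk h.choose_spec.2]
  refine ⟨p, hp, fun z => ?_⟩
  by_cases h : ∃ k ∈ J, t k = z
  · obtain ⟨k, hk, rfl⟩ := h
    exact Or.inr ⟨k, hk, rfl, hp k hk⟩
  · exact Or.inl (dif_neg h)

theorem _root_.Polynomial.eq_X_pow_add_sum_add_sum {R : Type*} [CommRing R] {Q : Polynomial R}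
    {E : ℕ} (hE : Q.coeff E = 1) (hd : E ≤ Q.natDegree) :
    Q = Polynomial.X ^ E + ∑ i ∈ Finset.range E, Polynomial.C (Q.coeff i) * Polynomial.X ^ i +
      ∑ i ∈ Finset.Ico (E + 1) (Q.natDegree + 1),
        Polynomial.C (Q.coeff i) * Polynomial.X ^ i := by
  conv_lhs => rw [Q.as_sum_range_C_mul_X_pow, Finset.range_eq_Ico,
    ← Finset.sum_Ico_consecutive _ (Nat.zero_le E) (by omega : E ≤ Q.natDegree + 1),
    Finset.sum_eq_sum_Ico_succ_bot (by omega : E < Q.natDegree + 1), hE, map_one, one_mul]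
  rw [Finset.range_eq_Ico]
  ring

namespace WeierstrassAlgebra

variable {ι A : Type*} [CommRing A]

section Evaluation

variable {K : Type*} [Field K] {Γ : Type*} [LinearOrderedCommGroupWithZero Γ]

/-- Points of the product of closed and open unit discs on which the series in `W` are evaluated. -/
def Point (W : WeierstrassAlgebra ι A) (v : Valuation K Γ) : Type _ :=
  {p : ι → v.integer // ∀ s ∈ W.small, v (p s : K) < 1}

/-- An evaluation of the series in `W` at all points, such that the value depends only on the
coordinates of the variables that occur. -/
@[ext]
structure Evaluation (W : WeierstrassAlgebra ι A) (v : Valuation K Γ) where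
  hom : W.Point v → W.B →+* v.integer
  map_X : ∀ p s, hom p ⟨MvPowerSeries.X s, W.X_mem s⟩ = p.1 s
  congr : ∀ (p p' : W.Point v) (S : Set ι) (f : W.B), OnlyVars S (f : MvPowerSeries ι A) →
    (∀ s ∈ S, p.1 s = p'.1 s) → hom p f = hom p' f

variable {W : WeierstrassAlgebra ι A} {v : Valuation K Γ}

/-- Every element of absolute value less than one is a value of `e X_t`, for all `t ∈ Z`. -/
def Evaluation.IsGeneric (σ : W.Evaluation v) : Prop :=
  ∀ a : v.integer, v (a : K) < 1 → ∃ x : v.integer,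
    (∀ p, a = σ.hom p (algebraMap A W.B W.e) * x) ∧ ∀ t ∈ W.Z, t ∈ W.small → v (x : K) < 1

/-- The restriction of an evaluation to the series in the variables from `U`. -/
noncomputable def Evaluation.homOn (σ : W.Evaluation v) (p : W.Point v) (U : Set ι) :
    W.on U →+* v.integer :=
  (σ.hom p).comp (Subalgebra.inclusion inf_le_left).toRingHom

theorem Evaluation.homOn_apply (σ : W.Evaluation v) (p : W.Point v) {U : Set ι}
    {f : MvPowerSeries ι A} (hf : f ∈ W.on U) : σ.homOn p U ⟨f, hf⟩ = σ.hom p ⟨f, hf.1⟩ :=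
  rfl

/-- Weierstrass preparation: the polynomial is regular of degree `E` in `X_s`, so it is a unit times
a monic polynomial `w` of degree `E`. By uniqueness of division by `w`, the unit is itself a
polynomial in `X_s`. -/
theorem exists_generic_factorization {s : ι} (hs : s ∉ W.small) (E d : ℕ) (t : ℕ → ι)
    (ht : ∀ i, t i ≠ s) (hZ : ∀ i ∈ Finset.Ico (E + 1) (d + 1), t i ∈ W.Z)
    [Nontrivial (W.on {s}ᶜ)] :
    ∃ w g : Polynomial (W.on {s}ᶜ), w.Monic ∧ w.natDegree = E ∧
      Polynomial.X ^ E +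
        ∑ i ∈ Finset.range E, Polynomial.C ⟨MvPowerSeries.X (t i), X_mem_on (ht i)⟩ *
          Polynomial.X ^ i +
        ∑ i ∈ Finset.Ico (E + 1) (d + 1), Polynomial.C (algebraMap A _ W.e *
          ⟨MvPowerSeries.X (t i), X_mem_on (ht i)⟩) * Polynomial.X ^ i = w * g := by
  set F : Polynomial (W.on {s}ᶜ) := _ + _ + ∑ i ∈ Finset.Ico (E + 1) (d + 1), _ with hFdef
  set Xs : MvPowerSeries ι A := MvPowerSeries.X s with hXs
  have hXB : ∀ i, Xs ^ i ∈ W.B := fun i => pow_mem (W.X_mem s) i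
  set ε : ℕ → MvPowerSeries ι A := fun i => algebraMap A _ W.e * MvPowerSeries.X (t i) with hε
  have hεB : ∀ i, ε i ∈ W.B := fun i => mul_mem (W.B.algebraMap_mem _) (W.X_mem _)
  have hεn : ∀ i ∈ Finset.Ico (E + 1) (d + 1), ε i ∈ W.nil :=
    fun i hi => W.e_mul_X_mem _ (hZ i hi)
  set f : MvPowerSeries ι A := Xs ^ E + ∑ i ∈ Finset.range E, MvPowerSeries.X (t i) * Xs ^ i +
    ∑ i ∈ Finset.Ico (E + 1) (d + 1), ε i * Xs ^ i with hf
  have hFf : Polynomial.aeval Xs F = f := by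
    simp only [hFdef, hf, map_add, map_sum, map_mul, map_pow, Polynomial.aeval_X,
      Polynomial.aeval_C]
    rfl
  have hD : HasDivision W.B s E f := W.division_xi s hs E (fun i => MvPowerSeries.X (t i)) _
    (fun i _ => ⟨W.X_mem _, onlyVars_X (ht i)⟩)
    (sum_mem fun i _ => mul_mem (hεB i) (hXB i))
    (sum_mem fun i hi => Ideal.mul_mem_right _ _ (hεn i hi))
  have hset : ∀ {r : MvPowerSeries ι A} {n : ℕ},
      IsPolyOfDegreeLT {a | a ∈ W.B ∧ OnlyVars {s}ᶜ a} s n r ↔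
      IsPolyOfDegreeLT (W.on {s}ᶜ : Set (MvPowerSeries ι A)) s n r := Iff.rfl
  have hqr : ∀ i, ∃ q ∈ W.B, ∃ p : Polynomial (W.on {s}ᶜ), p.degree < (E : WithBot ℕ) ∧
      Xs ^ i = q * f + Polynomial.aeval Xs p := by
    intro i
    obtain ⟨⟨q, r⟩, ⟨hq, hr, h⟩, -⟩ := hD _ (hXB i)
    obtain ⟨p, hp, hpr⟩ := (hset.1 hr).exists_polynomial
    exact ⟨q, hq, p, hp, by rw [hpr]; exact h⟩
  choose q hq p hp hqp using hqr
  -- Replacing each `X_s^i` with `i > E` in `f` by its remainder `p i` modulo `f` subtracts `(∑ ε i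
  -- * q i) * f`, leaving the monic polynomial `w = u * f`.
  set u : MvPowerSeries ι A := 1 - ∑ i ∈ Finset.Ico (E + 1) (d + 1), ε i * q i with hu
  have hD0 : HasDivision W.B s 0 u := by
    have := W.division_xi s hs 0 (fun _ => 0)
      (-∑ i ∈ Finset.Ico (E + 1) (d + 1), ε i * q i) (by simp)
      (neg_mem (sum_mem fun i _ => mul_mem (hεB i) (hq i)))
      (neg_mem (sum_mem fun i hi => Ideal.mul_mem_right _ _ (hεn i hi)))
    simpa [← sub_eq_add_neg] using this
  -- `u` is regular of degree `0`, so division of `1` by it has remainder `0` and shows that `u` is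
  -- a unit.
  obtain ⟨⟨u', r₀⟩, ⟨hu', ⟨c₀, -, hr₀⟩, h1⟩, -⟩ := hD0 1 (one_mem _)
  simp only [Finset.range_zero, Finset.sum_empty] at hr₀ h1
  rw [hr₀, add_zero] at h1
  set l : Polynomial (W.on {s}ᶜ) :=
    ∑ i ∈ Finset.range E, Polynomial.C ⟨MvPowerSeries.X (t i), X_mem_on (ht i)⟩ *
      Polynomial.X ^ i + ∑ i ∈ Finset.Ico (E + 1) (d + 1), Polynomial.C (algebraMap A _ W.e *
      ⟨MvPowerSeries.X (t i), X_mem_on (ht i)⟩) * p i with hl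
  have hldeg : l.degree < (E : WithBot ℕ) := by
    refine (Polynomial.degree_add_le _ _).trans_lt (max_lt ?_ ?_)
    · rw [Finset.sum_range]
      exact Polynomial.degree_sum_fin_lt (fun i : Fin E => _)
    · refine (Polynomial.degree_sum_le _ _).trans_lt
        ((Finset.sup_lt_iff (WithBot.bot_lt_coe E)).2 fun i _ => ?_)
      rw [← Polynomial.smul_eq_C_mul]
      exact (Polynomial.degree_smul_le _ _).trans_lt (hp i)
  have hlval : Polynomial.aeval Xs l = ∑ i ∈ Finset.range E, MvPowerSeries.X (t i) * Xs ^ i +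
      ∑ i ∈ Finset.Ico (E + 1) (d + 1), ε i * Polynomial.aeval Xs (p i) := by
    simp only [hl, map_add, map_sum, map_mul, map_pow, Polynomial.aeval_X, Polynomial.aeval_C]
    rfl
  set w : Polynomial (W.on {s}ᶜ) := Polynomial.X ^ E + l with hw
  have hwm : w.Monic := Polynomial.monic_X_pow_add hldeg
  have hwE : w.natDegree = E := by
    refine Polynomial.natDegree_eq_of_degree_eq_some ?_
    rw [hw, Polynomial.degree_add_eq_left_of_degree_lt, Polynomial.degree_X_pow]
    rwa [Polynomial.degree_X_pow]
  have hwuf : Polynomial.aeval Xs w = u * f := by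
    have h2 : ∑ i ∈ Finset.Ico (E + 1) (d + 1), ε i * Xs ^ i =
        (∑ i ∈ Finset.Ico (E + 1) (d + 1), ε i * q i) * f +
        ∑ i ∈ Finset.Ico (E + 1) (d + 1), ε i * Polynomial.aeval Xs (p i) := by
      rw [Finset.sum_mul, ← Finset.sum_add_distrib]
      exact Finset.sum_congr rfl fun i _ => by rw [hqp i]; ring
    rw [hw, map_add, map_pow, Polynomial.aeval_X, hlval, hu, sub_mul, one_mul]
    linear_combination -hf - h2
  have hDw : HasDivision W.B s E (Polynomial.aeval Xs w) := by
    obtain ⟨c, hc, h⟩ := isPolyOfDegreeLT_aeval (s := s) hldeg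
    have := W.division_xi s hs E c 0 hc (zero_mem _) (zero_mem _)
    rw [add_zero, ← h] at this
    rwa [hw, map_add, map_pow, Polynomial.aeval_X]
  have hfw : f = u' * Polynomial.aeval Xs w := by
    rw [hwuf, ← mul_assoc, ← h1, one_mul]
  have hmemB : ∀ P : Polynomial (W.on {s}ᶜ), Polynomial.aeval Xs P ∈ W.B := by
    intro P
    rw [Polynomial.aeval_eq_sum_range]
    exact sum_mem fun i _ => mul_mem (P.coeff i).2.1 (hXB i)
  have hmod := Polynomial.modByMonic_add_div F w
  have hdeg : (F %ₘ w).degree < (E : WithBot ℕ) := by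
    have := Polynomial.degree_modByMonic_lt F hwm
    rwa [Polynomial.degree_eq_natDegree hwm.ne_zero, hwE] at this
  -- Compare the exact division `f = u' * w` with polynomial division of `F` by `w`: the polynomial
  -- remainder must vanish.
  have huniq := (hDw f (hFf ▸ hmemB F)).unique (y₁ := (u', 0))
    (y₂ := (Polynomial.aeval Xs (F /ₘ w), Polynomial.aeval Xs (F %ₘ w)))
    ⟨hu', ⟨0, fun _ _ => (W.on {s}ᶜ).zero_mem, by simp⟩, by rw [add_zero]; exact hfw⟩
    ⟨hmemB _, isPolyOfDegreeLT_aeval hdeg, by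
      rw [← hFf, ← hmod, map_add, map_mul, hmod]
      ring⟩
  have h0 : F %ₘ w = 0 :=
    aeval_X_injective (fun _ h => (mem_on.1 h).2) ((congrArg Prod.snd huniq).symm.trans (map_zero _).symm)
  refine ⟨w, F /ₘ w, hwm, hwE, ?_⟩
  rw [h0, zero_add] at hmod
  exact hmod.symm

/-- Specializes the generic factorization: a coefficient below degree `E` is the value of a
variable, and one above is the value of some `e X_t` by genericity. -/
theorem Evaluation.exists_factorization (σ : W.Evaluation v) (hσ : σ.IsGeneric)
    {Q : Polynomial v.integer} {E : ℕ} (hE : Q.coeff E = 1)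
    (hQ : ∀ i, E < i → v (Q.coeff i : K) < 1) :
    ∃ w g : Polynomial v.integer, w.Monic ∧ w.natDegree = E ∧ Q = w * g := by
  obtain ⟨s, hs⟩ := W.exists_not_small
  have : Nonempty ι := ⟨s⟩
  have hEd : E ≤ Q.natDegree := Polynomial.le_natDegree_of_ne_zero (by rw [hE]; exact one_ne_zero)
  set d := Q.natDegree with hd
  obtain ⟨t, htinj, ht⟩ := exists_injOn_mem (Finset.range E ∪ Finset.Ico (E + 1) (d + 1))
    (fun i => if i < E then {t | t ∈ W.small ↔ s ∈ W.small} else W.Z) (fun i _ => by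
      by_cases hi : i < E
      · simpa only [if_pos hi] using W.infinite_kind s
      · simpa only [if_neg hi] using W.infinite_Z) {s}
  have hx : ∀ i, ∃ x : v.integer, (i < E → x = Q.coeff i) ∧
      (E < i → (∀ p, Q.coeff i = σ.hom p (algebraMap A W.B W.e) * x) ∧
        ∀ t ∈ W.Z, t ∈ W.small → v (x : K) < 1) := by
    intro i
    rcases lt_or_ge E i with hi | hi
    · obtain ⟨x, hx⟩ := hσ _ (hQ i hi)
      exact ⟨x, fun h => absurd h (by omega), fun _ => hx⟩
    · exact ⟨Q.coeff i, fun _ => rfl, fun h => absurd h (by omega)⟩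
  choose x hxlt hxgt using hx
  obtain ⟨p₀, hp₀, hp₀'⟩ := exists_fun_of_injOn htinj x
  have hsmall : ∀ z ∈ W.small, v (p₀ z : K) < 1 := by
    intro z hz
    rcases hp₀' z with h | ⟨i, hi, rfl, h⟩
    · rw [h]
      simp
    · rw [h]
      have hti := (ht i hi).1
      rcases Finset.mem_union.1 hi with hi | hi
      · rw [if_pos (Finset.mem_range.1 hi)] at hti
        exact absurd (hti.1 hz) hs
      · have := (Finset.mem_Ico.1 hi).1
        rw [if_neg (by omega)] at hti
        exact (hxgt i (by omega)).2 _ hti hz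
  let p : W.Point v := ⟨p₀, hsmall⟩
  classical
  -- Outside the relevant indices `t` may take the value `s`. It is changed there so that no index
  -- has to be excluded.
  let t' : ℕ → ι := fun i => if t i = s then W.infinite_Z.exists_notMem_finset {s} |>.choose else t i
  have ht's : ∀ i, t' i ≠ s := by
    intro i
    by_cases h : t i = s
    · simp only [t', if_pos h]
      simpa using (W.infinite_Z.exists_notMem_finset {s}).choose_spec.2
    · simpa only [t', if_neg h] using h
  have ht' : ∀ i ∈ Finset.range E ∪ Finset.Ico (E + 1) (d + 1), t' i = t i := fun i hi =>
    if_neg fun h => (ht i hi).2 (Finset.mem_singleton.2 h)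
  have hnon : Nontrivial (W.on ({s}ᶜ : Set ι)) := (σ.homOn p {s}ᶜ).domain_nontrivial
  obtain ⟨w, g, hwm, hwE, hwg⟩ := exists_generic_factorization (W := W) hs E d t' ht's
    (fun i hi => by
      have h1 := ht i (Finset.mem_union_right _ hi)
      rw [ht' i (Finset.mem_union_right _ hi)]
      have := (Finset.mem_Ico.1 hi).1
      rw [if_neg (by omega)] at h1
      exact h1.1)
  have hval : ∀ i ∈ Finset.range E ∪ Finset.Ico (E + 1) (d + 1),
      σ.homOn p {s}ᶜ ⟨MvPowerSeries.X (t' i), X_mem_on (ht's i)⟩ = x i := by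
    intro i hi
    rw [Evaluation.homOn_apply, σ.map_X, ht' i hi]
    exact hp₀ i hi
  have he : σ.homOn p {s}ᶜ (algebraMap A _ W.e) = σ.hom p (algebraMap A W.B W.e) := rfl
  generalize σ.homOn p {s}ᶜ = φ at hval he
  refine ⟨w.map φ, g.map φ, hwm.map _, ?_, ?_⟩
  · rw [hwm.natDegree_map, hwE]
  · rw [← Polynomial.map_mul, ← hwg]
    refine (Polynomial.eq_X_pow_add_sum_add_sum hE hEd).trans ?_
    rw [Polynomial.map_add, Polynomial.map_add, Polynomial.map_pow, Polynomial.map_X,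
      Polynomial.map_sum, Polynomial.map_sum]
    congr 1
    · congr 1
      refine Finset.sum_congr rfl fun i hi => ?_
      rw [Polynomial.map_mul, Polynomial.map_pow, Polynomial.map_X, Polynomial.map_C,
        hval i (Finset.mem_union_left _ hi), hxlt i (Finset.mem_range.1 hi)]
    · refine Finset.sum_congr rfl fun i hi => ?_
      have hi' := (Finset.mem_Ico.1 hi).1
      rw [Polynomial.map_mul, Polynomial.map_pow, Polynomial.map_X, Polynomial.map_C, map_mul,
        hval i (Finset.mem_union_right _ hi), (hxgt i (by omega)).1 p, he]

end Evaluation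

end WeierstrassAlgebra

end AnalyticStructure

/-! ### Integrality of `K'°` over `K°`. -/

namespace AnalyticStructure

section Valued

variable {K : Type*} [Field K] {Γ : Type*} [LinearOrderedCommGroupWithZero Γ] {v : Valuation K Γ}

theorem exists_integral_scaling {Q : Polynomial K} (hQ : Q ≠ 0) :
    ∃ (a : K) (P : Polynomial v.integer) (E : ℕ), a ≠ 0 ∧
      P.map v.integer.subtype = Polynomial.C a * Q ∧ P.coeff E = 1 ∧
      ∀ i, E < i → v (P.coeff i : K) < 1 := by
  -- The lexicographic order selects the last among the coefficients of maximal absolute value, so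
  -- all later ones are strictly smaller.
  obtain ⟨E, hE, hmax⟩ := Q.support.exists_max_image (fun i => toLex (v (Q.coeff i), i))
    (Polynomial.support_nonempty.2 hQ)
  have hE0 : Q.coeff E ≠ 0 := Polynomial.mem_support_iff.1 hE
  have hvE : v (Q.coeff E) ≠ 0 := (v.ne_zero_iff).2 hE0
  have hle : ∀ i, v (Q.coeff i) ≤ v (Q.coeff E) ∧ (E < i → v (Q.coeff i) < v (Q.coeff E)) := by
    intro i
    by_cases hi : i ∈ Q.support
    · rcases (Prod.Lex.le_iff).1 (hmax i hi) with h | ⟨h, h'⟩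
      · exact ⟨h.le, fun _ => h⟩
      · exact ⟨h.le, fun hlt => absurd h' (not_le.2 hlt)⟩
    · rw [Polynomial.notMem_support_iff.1 hi, map_zero]
      exact ⟨zero_le, fun _ => zero_lt_iff.2 hvE⟩
  have hcoeff : ∀ i, v ((Q.coeff E)⁻¹ * Q.coeff i) ≤ 1 := by
    intro i
    rw [map_mul, map_inv₀, inv_mul_le_iff₀ (zero_lt_iff.2 hvE), mul_one]
    exact (hle i).1
  have hsub : (↑(Polynomial.C (Q.coeff E)⁻¹ * Q).coeffs : Set K) ⊆ v.integer := by
    intro c hc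
    obtain ⟨i, -, rfl⟩ := Polynomial.mem_coeffs_iff.1 hc
    rw [Polynomial.coeff_C_mul]
    exact hcoeff i
  refine ⟨(Q.coeff E)⁻¹, (Polynomial.C (Q.coeff E)⁻¹ * Q).toSubring v.integer hsub, E,
    inv_ne_zero hE0, Polynomial.map_toSubring _ _ _, ?_, fun i hi => ?_⟩
  · ext1
    rw [Polynomial.coeff_toSubring, Polynomial.coeff_C_mul, inv_mul_cancel₀ hE0]
    rfl
  · rw [Polynomial.coeff_toSubring, Polynomial.coeff_C_mul, map_mul, map_inv₀,
      inv_mul_lt_iff₀ (zero_lt_iff.2 hvE), mul_one]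
    exact (hle i).2 hi

variable {K' : Type*} [Field K'] {Γ' : Type*} [LinearOrderedCommGroupWithZero Γ'] [Algebra K K']
  {v' : Valuation K' Γ'} [v.HasExtension v']

/-- The value at `x` is `1` plus an element of absolute value less than one. -/
theorem eval₂_ne_zero_of_coeff_zero_eq_one {P : Polynomial v.integer} (h0 : P.coeff 0 = 1)
    (hP : ∀ i, 0 < i → v (P.coeff i : K) < 1) {x : K'} (hx : v' x ≤ 1) :
    P.eval₂ ((algebraMap K K').comp v.integer.subtype) x ≠ 0 := by
  intro h
  rw [Polynomial.eval₂_eq_sum_range, Finset.sum_range_succ', h0, map_one, pow_zero, one_mul] at h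
  have hlt : v' (∑ i ∈ Finset.range P.natDegree,
      ((algebraMap K K').comp v.integer.subtype) (P.coeff (i + 1)) * x ^ (i + 1)) < 1 := by
    refine v'.map_sum_lt one_ne_zero fun i _ => ?_
    rw [map_mul, map_pow]
    refine mul_lt_one_of_lt_of_le ?_ (pow_le_one₀ zero_le hx)
    exact (Valuation.HasExtension.val_map_lt_one_iff v v' _).2 (hP _ i.succ_pos)
  rw [eq_neg_of_add_eq_zero_left h, Valuation.map_neg, map_one] at hlt
  exact lt_irrefl _ hlt

end Valued

namespace WeierstrassAlgebra

variable {ι A : Type*} [CommRing A] {W : WeierstrassAlgebra ι A}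
  {K : Type*} [Field K] {Γ : Type*} [LinearOrderedCommGroupWithZero Γ] {v : Valuation K Γ}
  {K' : Type*} [Field K'] {Γ' : Type*} [LinearOrderedCommGroupWithZero Γ'] [Algebra K K']
  {v' : Valuation K' Γ'} [v.HasExtension v'] [Algebra.IsAlgebraic K K']

/-- A scaled minimal polynomial factors with a monic factor of degree `E`. Irreducibility makes one
factor constant, so `E` is `0` or the full degree. -/
theorem Evaluation.exists_monic_or_coeff_zero_eq_one (σ : W.Evaluation v) (hσ : σ.IsGeneric)
    (z : K') : ∃ P : Polynomial v.integer,
      P.eval₂ ((algebraMap K K').comp v.integer.subtype) z = 0 ∧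
      (P.Monic ∨ (P.coeff 0 = 1 ∧ ∀ i, 0 < i → v (P.coeff i : K) < 1)) := by
  have hint : IsIntegral K z := (Algebra.IsAlgebraic.isAlgebraic z).isIntegral
  have hirr := minpoly.irreducible hint
  obtain ⟨a, P, E, ha, hPmap, hPE, hPlt⟩ := exists_integral_scaling (v := v) hirr.ne_zero
  have hz : P.eval₂ ((algebraMap K K').comp v.integer.subtype) z = 0 := by
    rw [← Polynomial.eval₂_map, hPmap, ← Polynomial.aeval_def, map_mul, minpoly.aeval, mul_zero]
  refine ⟨P, hz, ?_⟩
  obtain ⟨w, g, hw, hwE, hwg⟩ := σ.exists_factorization hσ hPE hPlt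
  have hirr' : Irreducible (w.map v.integer.subtype * g.map v.integer.subtype) := by
    rw [← Polynomial.map_mul, ← hwg, hPmap]
    exact (irreducible_isUnit_mul (Polynomial.isUnit_C.2 ha.isUnit)).2 hirr
  rcases hirr'.isUnit_or_isUnit rfl with hu | hu
  · have hE0 : E = 0 := by
      rw [← hwE, ← hw.natDegree_map v.integer.subtype]
      exact Polynomial.natDegree_eq_zero_of_isUnit hu
    subst hE0
    exact Or.inr ⟨hPE, hPlt⟩
  · left
    have hg : g.natDegree = 0 := by
      rw [← Polynomial.natDegree_map_eq_of_injective v.integer.subtype_injective]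
      exact Polynomial.natDegree_eq_zero_of_isUnit hu
    have hd : P.natDegree ≤ E := by
      rw [hwg]
      refine Polynomial.natDegree_mul_le.trans ?_
      omega
    exact Polynomial.monic_of_natDegree_le_of_coeff_eq_one E hd hPE

/-- For `|x| = 1` the non-monic alternative would give `1` plus something small equal to `0`. For `0
< |x| < 1` the dichotomy is applied to `x⁻¹`, so as to control the lower coefficients as well. -/
theorem Evaluation.exists_root (σ : W.Evaluation v) (hσ : σ.IsGeneric) (x : v'.integer) :
    ∃ (d : ℕ) (c : ℕ → v.integer),
      x ^ d + ∑ i ∈ Finset.range d, algebraMap v.integer v'.integer (c i) * x ^ i = 0 ∧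
      (v' (x : K') < 1 → ∀ i < d, v (c i : K) < 1) := by
  suffices h : ∃ P : Polynomial v.integer, P.Monic ∧
      P.eval₂ ((algebraMap K K').comp v.integer.subtype) (x : K') = 0 ∧
      (v' (x : K') < 1 → ∀ i < P.natDegree, v (P.coeff i : K) < 1) by
    obtain ⟨P, hP, hroot, hlt⟩ := h
    refine ⟨P.natDegree, P.coeff, ?_, hlt⟩
    rw [hP.as_sum, Polynomial.eval₂_add, Polynomial.eval₂_pow, Polynomial.eval₂_X,
      Polynomial.eval₂_finsetSum] at hroot
    ext1
    rw [ZeroMemClass.coe_zero, ← hroot, Subring.coe_add, Subring.coe_pow, AddSubmonoidClass.coe_finsetSum]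
    congr 1
    refine Finset.sum_congr rfl fun i _ => ?_
    rw [Polynomial.eval₂_mul, Polynomial.eval₂_pow, Polynomial.eval₂_X, Polynomial.eval₂_C]
    rfl
  by_cases hx : v' (x : K') < 1
  · by_cases hx0 : (x : K') = 0
    · refine ⟨Polynomial.X, Polynomial.monic_X, by rw [Polynomial.eval₂_X, hx0], fun _ i hi => ?_⟩
      rw [Polynomial.natDegree_X, Nat.lt_one_iff] at hi
      subst hi
      simp
    obtain ⟨P, hroot, hP⟩ := σ.exists_monic_or_coeff_zero_eq_one hσ (x : K')⁻¹
    have hv0 : v' (x : K') ≠ 0 := (v'.ne_zero_iff).2 hx0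
    rcases hP with hP | ⟨hP0, hPlt⟩
    -- A monic equation would make `x⁻¹` integral, although its absolute value exceeds one.
    · exfalso
      have hint : IsIntegral v'.integer (x : K')⁻¹ := by
        refine ⟨P.map (algebraMap v.integer v'.integer), hP.map _, ?_⟩
        rw [Polynomial.eval₂_map, ← hroot]
        rfl
      have hmem : v' (x : K')⁻¹ ≤ 1 := (Valuation.integer.integers v').mem_of_integral hint
      rw [map_inv₀, inv_le_one₀ (zero_lt_iff.2 hv0)] at hmem
      exact absurd hmem (not_le.2 hx)
    · have hc0 : P.coeff 0 ≠ 0 := by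
        rw [hP0]
        exact one_ne_zero
      -- Reversal turns the constant term `1` into the leading coefficient and the small higher
      -- coefficients into the lower ones.
      refine ⟨P.reverse, ?_, ?_, fun _ i hi => ?_⟩
      · rw [Polynomial.Monic, Polynomial.reverse_leadingCoeff, Polynomial.trailingCoeff,
          Polynomial.natTrailingDegree_eq_zero.2 (Or.inr hc0), hP0]
      · let _ : Invertible (x : K')⁻¹ := invertibleOfNonzero (inv_ne_zero hx0)
        have := (Polynomial.eval₂_reverse_eq_zero_iff
          ((algebraMap K K').comp v.integer.subtype) (x : K')⁻¹ P).2 hroot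
        rwa [invOf_eq_inv, inv_inv] at this
      · have hdeg : i < P.natDegree := hi.trans_le (Polynomial.reverse_natDegree_le P)
        rw [Polynomial.coeff_reverse, Polynomial.revAt_le hdeg.le]
        exact hPlt _ (by omega)
  · obtain ⟨P, hroot, hP⟩ := σ.exists_monic_or_coeff_zero_eq_one hσ (x : K')
    rcases hP with hP | ⟨hP0, hPlt⟩
    · exact ⟨P, hP, hroot, fun h => absurd h hx⟩
    · exact absurd hroot (eval₂_ne_zero_of_coeff_zero_eq_one hP0 hPlt x.2)

end WeierstrassAlgebra

end AnalyticStructure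

/-! ### Evaluation at points of `K'`: existence, independence of choices and uniqueness. -/

namespace AnalyticStructure

namespace WeierstrassAlgebra

variable {ι A : Type*} [CommRing A] {W : WeierstrassAlgebra ι A}
  {K : Type*} [Field K] {Γ : Type*} [LinearOrderedCommGroupWithZero Γ] {v : Valuation K Γ}
  {K' : Type*} [Field K'] {Γ' : Type*} [LinearOrderedCommGroupWithZero Γ'] [Algebra K K']
  {v' : Valuation K' Γ'} [v.HasExtension v']

open Classical in
/-- The point with the coordinates of `p` for the variables in `F` and those of `q` for the other
variables. -/
noncomputable def Point.mix (F : Finset ι) (p q : W.Point v) : W.Point v :=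
  ⟨fun z => if z ∈ F then p.1 z else q.1 z, fun s hs => by
    dsimp only
    split_ifs
    · exact p.2 s hs
    · exact q.2 s hs⟩

theorem Point.mix_of_mem {F : Finset ι} (p q : W.Point v) {z : ι} (hz : z ∈ F) :
    (Point.mix F p q).1 z = p.1 z :=
  if_pos hz

theorem Point.mix_of_notMem {F : Finset ι} (p q : W.Point v) {z : ι} (hz : z ∉ F) :
    (Point.mix F p q).1 z = q.1 z :=
  if_neg hz

/-- The image of a point over an extension of valued fields. -/
def Point.map (p : W.Point v) (w : Valuation K' Γ') [v.HasExtension w] : W.Point w :=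
  ⟨fun z => algebraMap v.integer w.integer (p.1 z), fun s hs =>
    (Valuation.HasExtension.val_map_lt_one_iff v w _).2 (p.2 s hs)⟩

/-- The evaluation `τ` extends `σ`. -/
def Evaluation.Extends (τ : W.Evaluation v') (σ : W.Evaluation v) : Prop :=
  ∀ (p : W.Point v) (f : W.B),
    τ.hom (p.map v') f = algebraMap v.integer v'.integer (σ.hom p f)

/-- Each coefficient of each equation gets its own fresh variable, of the same kind as the variable
whose value is the root. This is consistent because a root in the open disc has an equation with
lower coefficients in the open disc. -/
theorem Evaluation.exists_frame [Algebra.IsAlgebraic K K'] (σ : W.Evaluation v)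
    (hσ : σ.IsGeneric) (p' : W.Point v') (T G : Finset ι) :
    ∃ (F : Finset ι) (p : W.Point v), (∀ z ∈ F, z ∉ G) ∧ W.IsFrame T F (p.map v').1 p'.1 := by
  classical
  have : Nonempty ι := ⟨W.exists_not_small.choose⟩
  choose d c hroot hlt using fun s => σ.exists_root (v' := v') hσ (p'.1 s)
  obtain ⟨t, hinj, ht⟩ := exists_injOn_mem (T.sigma fun s => Finset.range (d s))
    (fun k => {t | t ∈ W.small ↔ k.1 ∈ W.small}) (fun k _ => W.infinite_kind k.1) (G ∪ T)
  obtain ⟨p, hp, hp'⟩ := exists_fun_of_injOn hinj fun k => c k.1 k.2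
  refine ⟨(T.sigma fun s => Finset.range (d s)).image t, ⟨p, fun z hz => ?_⟩, fun z hz => ?_,
    ⟨fun s hs hsF => ?_, fun s hs => ⟨d s, fun i => t ⟨s, i⟩, fun i hi => ⟨?_, ?_⟩, ?_⟩⟩⟩
  · rcases hp' z with h | ⟨k, hk, rfl, h⟩
    · rw [h]
      simp
    · rw [h]
      have hks : k.1 ∈ W.small := (ht k hk).1.1 hz
      exact hlt k.1 (p'.2 _ hks) k.2 (Finset.mem_range.1 (Finset.mem_sigma.1 hk).2)
  · obtain ⟨k, hk, rfl⟩ := Finset.mem_image.1 hz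
    exact fun h => (ht k hk).2 (Finset.mem_union_left _ h)
  · obtain ⟨k, hk, rfl⟩ := Finset.mem_image.1 hsF
    exact (ht k hk).2 (Finset.mem_union_right _ hs)
  · exact Finset.mem_image_of_mem t (Finset.mem_sigma.2 ⟨hs, Finset.mem_range.2 hi⟩)
  · exact (ht ⟨s, i⟩ (Finset.mem_sigma.2 ⟨hs, Finset.mem_range.2 hi⟩)).1.2
  · rw [← hroot s]
    congr 1
    refine Finset.sum_congr rfl fun i hi => ?_
    have := hp ⟨s, i⟩ (Finset.mem_sigma.2 ⟨hs, hi⟩)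
    rw [← this]
    rfl

/-- The homomorphism `ψ` evaluates the series in the variables from `F ∪ T`: it extends the
evaluation `σ` at `p` of the series in the variables from `F`, the variables from `T` have the
values prescribed by `p'`, and these are roots of polynomials with coefficients from `F`. -/
structure Evaluation.IsModel (σ : W.Evaluation v) (p' : W.Point v') (T F : Finset ι)
    (p : W.Point v) (ψ : W.on (↑F ∪ ↑T : Set ι) →+* v'.integer) : Prop where
  frame : W.IsFrame T F (p.map v').1 p'.1
  map_X : ∀ s ∈ T, ∀ h, ψ ⟨MvPowerSeries.X s, h⟩ = p'.1 s
  map_on : ∀ f, ∀ h : f ∈ W.on F, ∀ h',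
    ψ ⟨f, h'⟩ = algebraMap v.integer v'.integer (σ.hom p ⟨f, h.1⟩)

namespace Evaluation

variable {σ : W.Evaluation v} {p' : W.Point v'}

theorem exists_isModel_of_frame {T F : Finset ι} {p : W.Point v}
    (h : W.IsFrame T F (p.map v').1 p'.1) : ∃ ψ, σ.IsModel p' T F p ψ := by
  obtain ⟨ψ, hX, hF⟩ := IsFrame.exists_hom
    ((algebraMap v.integer v'.integer).comp (σ.homOn p F)) (fun t ht ht' => by
      rw [RingHom.comp_apply, homOn_apply, σ.map_X]
      rfl) T h _ rfl
  exact ⟨ψ, h, hX, hF⟩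

theorem IsModel.unique {T F : Finset ι} {p : W.Point v}
    {ψ ψ' : W.on (↑F ∪ ↑T : Set ι) →+* v'.integer} (h : σ.IsModel p' T F p ψ)
    (h' : σ.IsModel p' T F p ψ') : ψ = ψ' := by
  refine IsFrame.hom_ext T h.frame rfl (fun t ht _ => ?_) h.map_X h'.map_X fun f hf hf' => ?_
  · rw [h.map_on _ (X_mem_on ht), σ.map_X]
    rfl
  · rw [h.map_on f hf, h'.map_on f hf]

/-- A model restricts to a model for smaller sets of variables. -/
theorem IsModel.restrict {T T₁ F F₁ : Finset ι} {p p₁ : W.Point v}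
    {ψ : W.on (↑F ∪ ↑T : Set ι) →+* v'.integer} (h : σ.IsModel p' T F p ψ) (hT : T₁ ⊆ T)
    (hF : F₁ ⊆ F) (hp : ∀ z ∈ F₁, p.1 z = p₁.1 z) (h₁ : W.IsFrame T₁ F₁ (p₁.map v').1 p'.1) :
    σ.IsModel p' T₁ F₁ p₁ (ψ.comp (Subalgebra.inclusion (on_mono (Set.union_subset_union
      (Finset.coe_subset.2 hF) (Finset.coe_subset.2 hT)))).toRingHom) where
  frame := h₁
  map_X s hs _ := h.map_X s (hT hs) _
  map_on f hf _ := by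
    refine (h.map_on f (on_mono (Finset.coe_subset.2 hF) hf) _).trans ?_
    rw [σ.congr p p₁ F₁ ⟨f, hf.1⟩ hf.2 hp]

/-- With `F₁` and `F₂` disjoint, both families of coefficients are coordinates of a single point. A
model over `F₁ ∪ F₂`, built with the equations of `F₁`, restricts to a model over each, hence to
`ψ₁` and to `ψ₂`. -/
theorem IsModel.eq_of_disjoint {T F₁ F₂ : Finset ι} {p₁ p₂ : W.Point v}
    {ψ₁ : W.on (↑F₁ ∪ ↑T : Set ι) →+* v'.integer} {ψ₂ : W.on (↑F₂ ∪ ↑T : Set ι) →+* v'.integer}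
    (h₁ : σ.IsModel p' T F₁ p₁ ψ₁) (h₂ : σ.IsModel p' T F₂ p₂ ψ₂) (hF : ∀ z ∈ F₁, z ∉ F₂)
    {f : MvPowerSeries ι A} (hf : f ∈ W.on T) :
    ψ₁ ⟨f, on_mono Set.subset_union_right hf⟩ = ψ₂ ⟨f, on_mono Set.subset_union_right hf⟩ := by
  classical
  have hframe : W.IsFrame T (F₁ ∪ F₂) ((Point.mix F₁ p₁ p₂).map v').1 p'.1 := by
    refine h₁.frame.mono subset_rfl Finset.subset_union_left (fun s hs => ?_)
      (fun t ht => ?_) fun _ _ => rfl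
    · rw [Finset.mem_union, not_or]
      exact ⟨h₁.frame.notMem s hs, h₂.frame.notMem s hs⟩
    · exact congrArg (algebraMap v.integer v'.integer) (Point.mix_of_mem p₁ p₂ ht)
  obtain ⟨ψ, hψ⟩ := exists_isModel_of_frame (σ := σ) hframe
  have e₁ := (hψ.restrict subset_rfl Finset.subset_union_left
    (fun z hz => Point.mix_of_mem p₁ p₂ hz) h₁.frame).unique h₁
  have e₂ := (hψ.restrict subset_rfl Finset.subset_union_right
    (fun z hz => Point.mix_of_notMem p₁ p₂ fun hz' => hF z hz' hz) h₂.frame).unique h₂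
  rw [← e₁, ← e₂]
  rfl

variable [Algebra.IsAlgebraic K K']

theorem exists_isModel (hσ : σ.IsGeneric) (p' : W.Point v') (T G : Finset ι) :
    ∃ F p ψ, (∀ z ∈ F, z ∉ G) ∧ σ.IsModel p' T F p ψ := by
  obtain ⟨F, p, hF, h⟩ := σ.exists_frame hσ p' T G
  obtain ⟨ψ, hψ⟩ := exists_isModel_of_frame (σ := σ) h
  exact ⟨F, p, ψ, hF, hψ⟩

/-- `F₁` and `F₂` may share variables with conflicting values, or meet the other `T`. So both models
are cut down to `T₁ ∩ T₂` and compared with a third one whose coefficient variables avoid both. -/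
theorem IsModel.eq (hσ : σ.IsGeneric) {T₁ T₂ F₁ F₂ : Finset ι} {p₁ p₂ : W.Point v}
    {ψ₁ : W.on (↑F₁ ∪ ↑T₁ : Set ι) →+* v'.integer} {ψ₂ : W.on (↑F₂ ∪ ↑T₂ : Set ι) →+* v'.integer}
    (h₁ : σ.IsModel p' T₁ F₁ p₁ ψ₁) (h₂ : σ.IsModel p' T₂ F₂ p₂ ψ₂)
    {f : MvPowerSeries ι A} (hf₁ : f ∈ W.on T₁) (hf₂ : f ∈ W.on T₂) :
    ψ₁ ⟨f, on_mono Set.subset_union_right hf₁⟩ = ψ₂ ⟨f, on_mono Set.subset_union_right hf₂⟩ := by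
  classical
  obtain ⟨F, p, ψ, hF, hψ⟩ := exists_isModel hσ p' (T₁ ∩ T₂) (F₁ ∪ F₂)
  have hf : f ∈ W.on ↑(T₁ ∩ T₂) := ⟨hf₁.1, by
    rw [Finset.coe_inter]
    exact OnlyVars.inter hf₁.2 hf₂.2⟩
  have r₁ := h₁.restrict (T₁ := T₁ ∩ T₂) Finset.inter_subset_left subset_rfl (fun _ _ => rfl)
    (h₁.frame.mono Finset.inter_subset_left subset_rfl
      (fun s hs => h₁.frame.notMem s (Finset.mem_inter.1 hs).1) (fun _ _ => rfl) fun _ _ => rfl)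
  have r₂ := h₂.restrict (T₁ := T₁ ∩ T₂) Finset.inter_subset_right subset_rfl (fun _ _ => rfl)
    (h₂.frame.mono Finset.inter_subset_right subset_rfl
      (fun s hs => h₂.frame.notMem s (Finset.mem_inter.1 hs).2) (fun _ _ => rfl) fun _ _ => rfl)
  have e₁ := hψ.eq_of_disjoint r₁ (fun z hz h => hF z hz (Finset.mem_union_left _ h)) hf
  have e₂ := hψ.eq_of_disjoint r₂ (fun z hz h => hF z hz (Finset.mem_union_right _ h)) hf
  exact e₁.symm.trans e₂

theorem exists_mem_on (f : W.B) : ∃ T : Finset ι, (f : MvPowerSeries ι A) ∈ W.on T := by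
  obtain ⟨T, hT⟩ := W.exists_finset f f.2
  exact ⟨T, f.2, hT⟩

theorem exists_value (hσ : σ.IsGeneric) (p' : W.Point v') (f : W.B) :
    ∃ y : v'.integer, ∀ (T F : Finset ι) (p : W.Point v) ψ, σ.IsModel p' T F p ψ →
      ∀ hf : (f : MvPowerSeries ι A) ∈ W.on T, y = ψ ⟨f, on_mono Set.subset_union_right hf⟩ := by
  obtain ⟨T, hT⟩ := exists_mem_on f
  obtain ⟨F, p, ψ, -, hψ⟩ := exists_isModel hσ p' T ∅
  exact ⟨_, fun T' F' p₁ ψ' hψ' hf => hψ.eq hσ hψ' hT hf⟩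

theorem exists_evaluation (hσ : σ.IsGeneric) :
    ∃ τ : W.Evaluation v', ∀ p' (f : W.B) (T F : Finset ι) (p : W.Point v) ψ,
      σ.IsModel p' T F p ψ → ∀ hf : (f : MvPowerSeries ι A) ∈ W.on T,
        τ.hom p' f = ψ ⟨f, on_mono Set.subset_union_right hf⟩ := by
  classical
  choose val hval using fun p' : W.Point v' => exists_value hσ p'
  have h2 : ∀ p' (f g : W.B), val p' (f + g) = val p' f + val p' g ∧
      val p' (f * g) = val p' f * val p' g := by
    intro p' f g
    obtain ⟨T₁, hT₁⟩ := exists_mem_on f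
    obtain ⟨T₂, hT₂⟩ := exists_mem_on g
    have hf : (f : MvPowerSeries ι A) ∈ W.on ↑(T₁ ∪ T₂) :=
      on_mono (Finset.coe_subset.2 Finset.subset_union_left) hT₁
    have hg : (g : MvPowerSeries ι A) ∈ W.on ↑(T₁ ∪ T₂) :=
      on_mono (Finset.coe_subset.2 Finset.subset_union_right) hT₂
    obtain ⟨F, p, ψ, -, hψ⟩ := exists_isModel hσ p' (T₁ ∪ T₂) ∅
    rw [hval p' f _ _ _ _ hψ hf, hval p' g _ _ _ _ hψ hg,
      hval p' (f + g) _ _ _ _ hψ (add_mem hf hg), hval p' (f * g) _ _ _ _ hψ (mul_mem hf hg),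
      ← map_add, ← map_mul]
    exact ⟨rfl, rfl⟩
  have h1 : ∀ p' : W.Point v', val p' 0 = 0 ∧ val p' 1 = 1 := by
    intro p'
    obtain ⟨F, p, ψ, -, hψ⟩ := exists_isModel hσ p' ∅ ∅
    exact ⟨(hval p' 0 _ _ _ _ hψ (zero_mem _)).trans (map_zero ψ),
      (hval p' 1 _ _ _ _ hψ (one_mem _)).trans (map_one ψ)⟩
  refine ⟨{
    hom := fun p' =>
      { toFun := val p'
        map_one' := (h1 p').2
        map_mul' := fun f g => (h2 p' f g).2
        map_zero' := (h1 p').1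
        map_add' := fun f g => (h2 p' f g).1 }
    map_X := fun p' s => ?_
    congr := fun p' p'' S f hf hS => ?_ }, hval⟩
  · obtain ⟨F, p, ψ, -, hψ⟩ := exists_isModel hσ p' {s} ∅
    exact (hval p' _ _ _ _ _ hψ (X_mem_on (by simp))).trans
      (hψ.map_X s (Finset.mem_singleton_self s) _)
  · obtain ⟨T, hT⟩ := exists_mem_on f
    -- Only variables of `S` matter to `f`, and `p'` and `p''` agree on these, so one model serves
    -- both points.
    have hT' : (f : MvPowerSeries ι A) ∈ W.on ↑(T.filter (· ∈ S)) := ⟨f.2, by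
      refine (hT.2.inter hf).mono fun z hz => ?_
      simpa using hz⟩
    have hpp : ∀ s ∈ T.filter (· ∈ S), p''.1 s = p'.1 s :=
      fun s hs => (hS s (Finset.mem_filter.1 hs).2).symm
    obtain ⟨F, p, ψ, -, hψ⟩ := exists_isModel hσ p' (T.filter (· ∈ S)) ∅
    have hψ' : σ.IsModel p'' (T.filter (· ∈ S)) F p ψ :=
      ⟨hψ.frame.mono subset_rfl subset_rfl hψ.frame.notMem (fun _ _ => rfl) hpp,
        fun s hs h => (hψ.map_X s hs h).trans (hpp s hs).symm, hψ.map_on⟩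
    exact (hval p' f _ _ _ _ hψ hT').trans (hval p'' f _ _ _ _ hψ' hT').symm

/-- At a point coming from `K`, evaluation by `σ` itself is a model, once the coefficient variables
are given the values that the frame requires. By uniqueness of models it computes the value. -/
theorem exists_extends (hσ : σ.IsGeneric) : ∃ τ : W.Evaluation v', τ.Extends σ := by
  obtain ⟨τ, hτ⟩ := exists_evaluation (v' := v') hσ
  refine ⟨τ, fun p f => ?_⟩
  obtain ⟨T, hT⟩ := exists_mem_on f
  obtain ⟨F, p₁, ψ, -, hψ⟩ := exists_isModel hσ (p.map v') T ∅
  have hmix : ∀ s ∈ T, (Point.mix F p₁ p).1 s = p.1 s :=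
    fun s hs => Point.mix_of_notMem _ _ (hψ.frame.notMem s hs)
  have hψ' : σ.IsModel (p.map v') T F p₁ ((algebraMap v.integer v'.integer).comp
      (σ.homOn (Point.mix F p₁ p) (↑F ∪ ↑T))) := by
    refine ⟨hψ.frame, fun s hs h => ?_, fun g hg h => ?_⟩
    · rw [RingHom.comp_apply, homOn_apply, σ.map_X, hmix s hs]
      rfl
    · rw [RingHom.comp_apply, homOn_apply,
        σ.congr _ p₁ F ⟨g, h.1⟩ hg.2 fun z hz => Point.mix_of_mem _ _ hz]
  rw [hτ _ f _ _ _ _ hψ' hT, RingHom.comp_apply, homOn_apply,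
    σ.congr _ p T ⟨f, hT.1⟩ hT.2 hmix]

/-- Changing the coordinates in `F` to the coefficients does not affect `f`. At the changed point
every extension of `σ` is a model, and models are unique. -/
theorem Extends.unique (hσ : σ.IsGeneric) {τ τ' : W.Evaluation v'} (h : τ.Extends σ)
    (h' : τ'.Extends σ) : τ = τ' := by
  ext p' f : 3
  obtain ⟨T, hT⟩ := exists_mem_on f
  obtain ⟨F, p, ψ, -, hψ⟩ := exists_isModel hσ p' T ∅
  have hmix : ∀ s ∈ T, p'.1 s = (Point.mix F (p.map v') p').1 s :=
    fun s hs => (Point.mix_of_notMem _ _ (hψ.frame.notMem s hs)).symm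
  have key : ∀ τ : W.Evaluation v', τ.Extends σ →
      σ.IsModel p' T F p (τ.homOn (Point.mix F (p.map v') p') (↑F ∪ ↑T)) := by
    intro τ hτ
    refine ⟨hψ.frame, fun s hs h => ?_, fun g hg h => ?_⟩
    · rw [homOn_apply, τ.map_X, hmix s hs]
    · rw [homOn_apply, τ.congr _ (p.map v') F ⟨g, h.1⟩ hg.2 fun z hz => Point.mix_of_mem _ _ hz]
      exact hτ p ⟨g, h.1⟩
  have := DFunLike.congr_fun ((key τ h).unique (key τ' h'))
    ⟨f, on_mono Set.subset_union_right hT⟩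
  rw [τ.congr _ _ T f hT.2 hmix, τ'.congr _ _ T f hT.2 hmix]
  exact this

end Evaluation

end WeierstrassAlgebra

end AnalyticStructure

/-! ### Increasing unions of rings of power series. -/

namespace AnalyticStructure

open Filter

section Union

variable {ι A : Type*} [CommRing A]

/-- The union of an increasing sequence of subalgebras. -/
def unionSubalgebra (R : ℕ → Subalgebra A (MvPowerSeries ι A)) (hR : Monotone R) :
    Subalgebra A (MvPowerSeries ι A) where
  carrier := {f | ∃ n, f ∈ R n}
  mul_mem' := by
    rintro f g ⟨m, hf⟩ ⟨n, hg⟩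
    exact ⟨max m n, mul_mem (hR (le_max_left m n) hf) (hR (le_max_right m n) hg)⟩
  add_mem' := by
    rintro f g ⟨m, hf⟩ ⟨n, hg⟩
    exact ⟨max m n, add_mem (hR (le_max_left m n) hf) (hR (le_max_right m n) hg)⟩
  algebraMap_mem' a := ⟨0, (R 0).algebraMap_mem a⟩

variable {R : ℕ → Subalgebra A (MvPowerSeries ι A)} {hR : Monotone R}

theorem le_unionSubalgebra (n : ℕ) : R n ≤ unionSubalgebra R hR :=
  fun _ h => ⟨n, h⟩

theorem eventually_mem_of_mem_unionSubalgebra {f : MvPowerSeries ι A}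
    (hf : f ∈ unionSubalgebra R hR) : ∀ᶠ n in atTop, f ∈ R n := by
  obtain ⟨n, hn⟩ := hf
  filter_upwards [eventually_ge_atTop n] with m hm
  exact hR hm hn

/-- A division is found in one large ring. Two divisions lie in a common ring, where uniqueness is
known. -/
theorem hasDivision_unionSubalgebra {s : ι} {d : ℕ} {f : MvPowerSeries ι A}
    (h : ∀ᶠ n in atTop, HasDivision (R n) s d f) :
    HasDivision (unionSubalgebra R hR) s d f := by
  intro g hg
  obtain ⟨n, hn, hgn⟩ := (h.and (eventually_mem_of_mem_unionSubalgebra hg)).exists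
  have hle : ∀ {n r}, IsPolyOfDegreeLT {a | a ∈ R n ∧ OnlyVars {s}ᶜ a} s d r →
      IsPolyOfDegreeLT {a | a ∈ unionSubalgebra R hR ∧ OnlyVars {s}ᶜ a} s d r := by
    rintro n r ⟨c, hc, hr⟩
    exact ⟨c, fun i hi => ⟨⟨n, (hc i hi).1⟩, (hc i hi).2⟩, hr⟩
  have hev : ∀ {r}, IsPolyOfDegreeLT {a | a ∈ unionSubalgebra R hR ∧ OnlyVars {s}ᶜ a} s d r →
      ∀ᶠ n in atTop, IsPolyOfDegreeLT {a | a ∈ R n ∧ OnlyVars {s}ᶜ a} s d r := by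
    rintro r ⟨c, hc, hr⟩
    have : ∀ᶠ n in atTop, ∀ i ∈ Finset.range d, c i ∈ R n :=
      (Finset.eventually_all _).2 fun i hi =>
        eventually_mem_of_mem_unionSubalgebra (hc i (Finset.mem_range.1 hi)).1
    filter_upwards [this] with n hn
    exact ⟨c, fun i hi => ⟨hn i (Finset.mem_range.2 hi), (hc i hi).2⟩, hr⟩
  obtain ⟨qr, ⟨hq, hr, hqr⟩, -⟩ := hn g hgn
  refine ⟨qr, ⟨⟨n, hq⟩, hle hr, hqr⟩, ?_⟩
  rintro qr' ⟨hq', hr', hqr'⟩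
  obtain ⟨m, hm, hgm, hqm, hqm', hrm, hrm'⟩ := (h.and
    ((eventually_mem_of_mem_unionSubalgebra hg).and
    ((eventually_mem_of_mem_unionSubalgebra (hR := hR) ⟨n, hq⟩).and
    ((eventually_mem_of_mem_unionSubalgebra hq').and
    ((hev (hle hr)).and (hev hr')))))).exists
  exact (hm g hgm).unique ⟨hqm', hrm', hqr'⟩ ⟨hqm, hrm, hqr⟩

theorem exists_hom_unionSubalgebra {L : Type*} [CommRing L] (φ : ∀ n, R n →+* L)
    (hφ : ∀ n f (h : f ∈ R n) (h' : f ∈ R (n + 1)), φ (n + 1) ⟨f, h'⟩ = φ n ⟨f, h⟩) :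
    ∃ ψ : unionSubalgebra R hR →+* L, ∀ n f (h : f ∈ R n),
      ψ ⟨f, le_unionSubalgebra n h⟩ = φ n ⟨f, h⟩ := by
  have hle : ∀ {m n f} (h : f ∈ R m), m ≤ n → ∀ h', φ n ⟨f, h'⟩ = φ m ⟨f, h⟩ := by
    intro m n f h hmn
    induction n, hmn using Nat.le_induction with
    | base => exact fun _ => rfl
    | succ n hmn ih => exact fun h' => (hφ n f (hR hmn h) h').trans (ih _)
  have heq : ∀ {m n f} (h : f ∈ R m) (h' : f ∈ R n), φ m ⟨f, h⟩ = φ n ⟨f, h'⟩ := by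
    intro m n f h h'
    rw [← hle h (le_max_left m n) (hR (le_max_left m n) h), ← hle h' (le_max_right m n)]
  choose N hN using fun f : unionSubalgebra R hR => f.2
  have hspec : ∀ (f : unionSubalgebra R hR) n (h : (f : MvPowerSeries ι A) ∈ R n),
      φ (N f) ⟨f, hN f⟩ = φ n ⟨f, h⟩ := fun f n h => heq _ h
  refine ⟨{
    toFun := fun f => φ (N f) ⟨f, hN f⟩
    map_one' := (hspec 1 0 (one_mem _)).trans (map_one (φ 0))
    map_zero' := (hspec 0 0 (zero_mem _)).trans (map_zero (φ 0))
    map_mul' := fun f g => ?_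
    map_add' := fun f g => ?_ }, fun n f h => hspec ⟨f, _⟩ n h⟩
  all_goals
    have hf := hR (le_max_left (N f) (N g)) (hN f)
    have hg := hR (le_max_right (N f) (N g)) (hN g)
  · rw [hspec f _ hf, hspec g _ hg, hspec (f * g) _ (mul_mem hf hg), ← map_mul]
    rfl
  · rw [hspec f _ hf, hspec g _ hg, hspec (f + g) _ (add_mem hf hg), ← map_add]
    rfl

/-- Pass from `x` to `x'` one coordinate at a time: those in `D` agree already, and the others do
not matter. -/
theorem eq_of_update_eq {n : ℕ} {X Y : Type*} (g : (Fin n → X) → Y) (D : Set (Fin n))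
    (hg : ∀ i ∉ D, ∀ x a, g (Function.update x i a) = g x) {x x' : Fin n → X}
    (h : ∀ i ∈ D, x i = x' i) : g x = g x' := by
  classical
  have key : ∀ s : Finset (Fin n), g (s.piecewise x' x) = g x := by
    intro s
    induction s using Finset.induction_on with
    | empty => rw [Finset.piecewise_empty]
    | insert j s hj ih =>
      rw [Finset.piecewise_insert]
      by_cases hjD : j ∈ D
      · rw [← h j hjD, ← Finset.piecewise_eq_of_notMem s x' x hj, Function.update_eq_self, ih]
      · rw [hg j hjD, ih]
  rw [← key Finset.univ, Finset.piecewise_univ]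

end Union

/-! ### The separated case. -/

section Separated

variable {A : Type*} [CommRing A] {I : Ideal A}

/-- The ideal of topologically nilpotent series. -/
noncomputable def sepNil (I : Ideal A) : Ideal (MvPowerSeries (ℕ ⊕ ℕ) A) :=
  residueIdeal (ℕ ⊕ ℕ) I ⊔ Ideal.span (MvPowerSeries.X '' Set.range Sum.inr)

/-- Membership uses only finitely many of the `ρ_j`, as the ideal is a directed union. -/
theorem eventually_mem_of_mem_sepNil {h : MvPowerSeries (ℕ ⊕ ℕ) A} (hh : h ∈ sepNil I) :
    ∀ᶠ n in atTop, h ∈ residueIdeal (ℕ ⊕ ℕ) I ⊔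
      Ideal.span {x | ∃ j < n, x = MvPowerSeries.X (Sum.inr j)} := by
  have hmono : Monotone fun n : ℕ => residueIdeal (ℕ ⊕ ℕ) I ⊔
      Ideal.span {x | ∃ j < n, x = MvPowerSeries.X (Sum.inr j)} := by
    intro m n hmn
    refine sup_le_sup_left (Ideal.span_mono ?_) _
    rintro x ⟨j, hj, rfl⟩
    exact ⟨j, hj.trans_le hmn, rfl⟩
  have hle : sepNil I ≤ ⨆ n : ℕ, (residueIdeal (ℕ ⊕ ℕ) I ⊔
      Ideal.span {x | ∃ j < n, x = MvPowerSeries.X (Sum.inr j)}) := by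
    refine sup_le (le_iSup_of_le 0 le_sup_left) (Ideal.span_le.2 ?_)
    rintro _ ⟨_, ⟨j, rfl⟩, rfl⟩
    exact Ideal.mem_iSup_of_mem (j + 1)
      (Ideal.mem_sup_right (Ideal.subset_span ⟨j, j.lt_succ_self, rfl⟩))
  obtain ⟨n, hn⟩ := (Submodule.mem_iSup_of_directed _ hmono.directed_le).1 (hle hh)
  filter_upwards [eventually_ge_atTop n] with m hm
  exact hmono hm hn

namespace SeparatedSystem

variable (𝒜 : SeparatedSystem A I)

theorem monotone_ring : Monotone fun n => 𝒜.ring n n :=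
  fun _ _ h => 𝒜.ring_mono h h

theorem hasDivision_xi (h𝒜 : 𝒜.IsPreWeierstrass) (i d : ℕ)
    (c : ℕ → MvPowerSeries (ℕ ⊕ ℕ) A) (h : MvPowerSeries (ℕ ⊕ ℕ) A)
    (hc : ∀ k < d, c k ∈ unionSubalgebra _ 𝒜.monotone_ring ∧ OnlyVars {Sum.inl i}ᶜ (c k))
    (hh : h ∈ unionSubalgebra _ 𝒜.monotone_ring) (hnil : h ∈ sepNil I) :
    HasDivision (unionSubalgebra _ 𝒜.monotone_ring) (Sum.inl i) d
      (MvPowerSeries.X (Sum.inl i) ^ d +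
        ∑ k ∈ Finset.range d, c k * MvPowerSeries.X (Sum.inl i) ^ k + h) := by
  refine hasDivision_unionSubalgebra ?_
  have hcev : ∀ᶠ n in atTop, ∀ k ∈ Finset.range d, c k ∈ 𝒜.ring n n :=
    (Finset.eventually_all _).2 fun k hk =>
      eventually_mem_of_mem_unionSubalgebra (hc k (Finset.mem_range.1 hk)).1
  filter_upwards [hcev, eventually_mem_of_mem_unionSubalgebra hh,
    eventually_mem_of_mem_sepNil hnil, eventually_gt_atTop i] with n hcn hhn hnn hin
  have hX : MvPowerSeries.X (Sum.inl i) ∈ 𝒜.ring n n := 𝒜.X_mem (s := Sum.inl i) hin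
  refine fun g hg => h𝒜.division_xi n n i d hin _ ?_ g hg ⟨_, ⟨_, ⟨c, fun k hk => ?_, rfl⟩, rfl⟩, ?_⟩
  · exact add_mem (add_mem (pow_mem hX _)
      (sum_mem fun k hk => mul_mem (hcn k hk) (pow_mem hX _))) hhn
  · exact (𝒜.onlyVars n n _ (hcn k (Finset.mem_range.2 hk))).inter (hc k hk).2
  · rwa [add_sub_cancel_left]

/-- All lower terms lie in the ideal generated by the other `ρ`-variables, so the divisor is
congruent to `ρ_j^d`. -/
theorem hasDivision_rho (h𝒜 : 𝒜.IsPreWeierstrass) (j d : ℕ)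
    (c : ℕ → MvPowerSeries (ℕ ⊕ ℕ) A)
    (hc : ∀ k < d, c k = 0 ∨ ∃ t ∈ Set.range Sum.inr, t ≠ Sum.inr j ∧ c k = MvPowerSeries.X t) :
    HasDivision (unionSubalgebra _ 𝒜.monotone_ring) (Sum.inr j) d
      (MvPowerSeries.X (Sum.inr j) ^ d +
        ∑ k ∈ Finset.range d, c k * MvPowerSeries.X (Sum.inr j) ^ k) := by
  refine hasDivision_unionSubalgebra ?_
  have hcev : ∀ᶠ n in atTop, ∀ k ∈ Finset.range d, c k = 0 ∨ ∃ j' < n, j' ≠ j ∧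
      c k = MvPowerSeries.X (Sum.inr j') := by
    refine (Finset.eventually_all _).2 fun k hk => ?_
    rcases hc k (Finset.mem_range.1 hk) with h | ⟨_, ⟨j', rfl⟩, hne, h⟩
    · exact Eventually.of_forall fun _ => Or.inl h
    · filter_upwards [eventually_gt_atTop j'] with n hn
      exact Or.inr ⟨j', hn, fun e => hne (e ▸ rfl), h⟩
  filter_upwards [hcev, eventually_gt_atTop j] with n hcn hjn
  have hX : MvPowerSeries.X (Sum.inr j) ∈ 𝒜.ring n n := 𝒜.X_mem (s := Sum.inr j) hjn
  refine fun g hg => h𝒜.division_rho n n j d hjn _ ?_ g hg ?_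
  · refine add_mem (pow_mem hX _) (sum_mem fun k hk => mul_mem ?_ (pow_mem hX _))
    rcases hcn k hk with h | ⟨j', hj', -, h⟩
    · rw [h]
      exact zero_mem _
    · rw [h]
      exact 𝒜.X_mem (s := Sum.inr j') hj'
  · rw [IsRegularRho, add_sub_cancel_left]
    refine sum_mem fun k hk => Ideal.mul_mem_right _ _ ?_
    rcases hcn k hk with h | ⟨j', hj', hne, h⟩
    · rw [h]
      exact zero_mem _
    · exact Ideal.mem_sup_right (Ideal.subset_span (Or.inl ⟨j', hj', hne, h⟩))

/-- The union of the rings `A_{m,n}` of a separated Weierstrass system. -/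
noncomputable def toWeierstrassAlgebra (h𝒜 : 𝒜.IsPreWeierstrass) :
    WeierstrassAlgebra (ℕ ⊕ ℕ) A where
  B := unionSubalgebra _ 𝒜.monotone_ring
  small := Set.range Sum.inr
  nil := sepNil I
  -- A `ρ`-variable can take any value in `K°°`, so no scaling is needed.
  e := 1
  Z := Set.range Sum.inr
  X_mem s := by
    rcases s with i | i
    · exact ⟨i + 1, 𝒜.X_mem (s := Sum.inl i) i.lt_succ_self⟩
    · exact ⟨i + 1, 𝒜.X_mem (s := Sum.inr i) i.lt_succ_self⟩
  exists_finset := by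
    rintro f ⟨n, hn⟩
    refine ⟨(Finset.range n).disjSum (Finset.range n), (𝒜.onlyVars n n f hn).mono ?_⟩
    rintro (i | i) hi
    · exact Finset.inl_mem_disjSum.2 (Finset.mem_range.2 hi)
    · exact Finset.inr_mem_disjSum.2 (Finset.mem_range.2 hi)
  infinite_kind s := by
    rcases s with i | i
    · refine (Set.infinite_range_of_injective (Sum.inl_injective (α := ℕ) (β := ℕ))).mono ?_
      rintro _ ⟨j, rfl⟩
      simp
    · refine (Set.infinite_range_of_injective (Sum.inr_injective (α := ℕ) (β := ℕ))).mono ?_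
      rintro _ ⟨j, rfl⟩
      simp
  exists_not_small := ⟨Sum.inl 0, by simp⟩
  infinite_Z := Set.infinite_range_of_injective Sum.inr_injective
  e_mul_X_mem t ht := by
    rw [map_one, one_mul]
    exact Ideal.mem_sup_right (Ideal.subset_span ⟨t, ht, rfl⟩)
  division_xi s hs d c h hc hh hn := by
    rcases s with i | i
    · exact 𝒜.hasDivision_xi h𝒜 i d c h hc hh hn
    · exact absurd ⟨i, rfl⟩ hs
  division_rho s hs d c hc := by
    obtain ⟨j, rfl⟩ := hs
    exact 𝒜.hasDivision_rho h𝒜 j d c hc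

end SeparatedSystem

namespace SeparatedStructure

variable {𝒜 : SeparatedSystem A I} {h𝒜 : 𝒜.IsPreWeierstrass}
  {K : Type*} [Field K] {Γ : Type*} [LinearOrderedCommGroupWithZero Γ] {v : Valuation K Γ}

/-- The first coordinates of a point. -/
def coords (p : (𝒜.toWeierstrassAlgebra h𝒜).Point v) (m n : ℕ) :
    (Fin m → v.integer) × (Fin n → OpenDisc v) :=
  (fun i => p.1 (Sum.inl i), fun j => ⟨p.1 (Sum.inr j), p.2 _ ⟨j, rfl⟩⟩)

open Classical in
variable (h𝒜) in
/-- The point with the given first coordinates, the other coordinates being `0`. -/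
noncomputable def pointOf {m n : ℕ} (q : (Fin m → v.integer) × (Fin n → OpenDisc v)) :
    (𝒜.toWeierstrassAlgebra h𝒜).Point v :=
  ⟨Sum.elim (fun i => if h : i < m then q.1 ⟨i, h⟩ else 0)
    (fun j => if h : j < n then (q.2 ⟨j, h⟩).1 else 0), by
    rintro _ ⟨j, rfl⟩
    simp only [Sum.elim_inr]
    split_ifs with h
    · exact (q.2 ⟨j, h⟩).2
    · simp⟩

theorem pointOf_inl {m n : ℕ} (q : (Fin m → v.integer) × (Fin n → OpenDisc v)) (i : Fin m) :
    (pointOf h𝒜 q).1 (Sum.inl (i : ℕ)) = q.1 i :=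
  dif_pos i.2

theorem pointOf_inr {m n : ℕ} (q : (Fin m → v.integer) × (Fin n → OpenDisc v)) (j : Fin n) :
    (pointOf h𝒜 q).1 (Sum.inr (j : ℕ)) = (q.2 j).1 :=
  dif_pos j.2

theorem coords_pointOf {m n : ℕ} (q : (Fin m → v.integer) × (Fin n → OpenDisc v)) :
    coords (pointOf h𝒜 q) m n = q := by
  refine Prod.ext (funext fun i => ?_) (funext fun j => Subtype.ext ?_)
  · exact pointOf_inl (h𝒜 := h𝒜) q i
  · exact pointOf_inr (h𝒜 := h𝒜) q j

theorem σ_coords_mono (σ : SeparatedStructure 𝒜 v) (p : (𝒜.toWeierstrassAlgebra h𝒜).Point v)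
    {m n m' n' : ℕ} (hm : m ≤ m') (hn : n ≤ n') {f : MvPowerSeries (ℕ ⊕ ℕ) A}
    (h : f ∈ 𝒜.ring m n) (h' : f ∈ 𝒜.ring m' n') :
    σ.σ m' n' ⟨f, h'⟩ (coords p m' n') = σ.σ m n ⟨f, h⟩ (coords p m n) := by
  have h1 : ∀ h1, σ.σ m' n ⟨f, h1⟩ (coords p m' n) = σ.σ m n ⟨f, h⟩ (coords p m n) := by
    clear h'
    induction m', hm using Nat.le_induction with
    | base => exact fun _ => rfl
    | succ k hk ih =>
      exact fun _ => (σ.map_incl_xi k n ⟨f, 𝒜.ring_mono hk le_rfl h⟩ _ _).trans (ih _)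
  induction n', hn using Nat.le_induction with
  | base => exact h1 h'
  | succ k hk ih =>
    exact (σ.map_incl_rho m' k ⟨f, 𝒜.ring_mono hm hk h⟩ _ _).trans (ih _)

theorem σ_congr (σ : SeparatedStructure 𝒜 v) {p p' : (𝒜.toWeierstrassAlgebra h𝒜).Point v}
    {S : Set (ℕ ⊕ ℕ)} {m n : ℕ} (f : 𝒜.ring m n) (hf : OnlyVars S (f : MvPowerSeries (ℕ ⊕ ℕ) A))
    (h : ∀ s ∈ S, p.1 s = p'.1 s) : σ.σ m n f (coords p m n) = σ.σ m n f (coords p' m n) := by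
  have h1 : σ.σ m n f ((coords p m n).1, (coords p m n).2) =
      σ.σ m n f ((coords p' m n).1, (coords p m n).2) :=
    eq_of_update_eq (fun x => σ.σ m n f (x, (coords p m n).2)) {i | Sum.inl (i : ℕ) ∈ S}
      (fun i hi x a => σ.indep_xi m n f i (hf.compl_singleton hi) x _ a) fun i hi => h _ hi
  have h2 : σ.σ m n f ((coords p' m n).1, (coords p m n).2) =
      σ.σ m n f ((coords p' m n).1, (coords p' m n).2) :=
    eq_of_update_eq (fun y => σ.σ m n f ((coords p' m n).1, y)) {j | Sum.inr (j : ℕ) ∈ S}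
      (fun j hj y b => σ.indep_rho m n f j (hf.compl_singleton hj) _ y b)
      fun j hj => Subtype.ext (h _ hj)
  exact h1.trans h2

variable (h𝒜) in
/-- A separated analytic structure evaluates the series in the union of the rings `A_{m,n}`. -/
theorem exists_evaluation (σ : SeparatedStructure 𝒜 v) :
    ∃ ε : (𝒜.toWeierstrassAlgebra h𝒜).Evaluation v, ∀ p m n f (h : f ∈ 𝒜.ring m n) h',
      ε.hom p ⟨f, h'⟩ = σ.σ m n ⟨f, h⟩ (coords p m n) := by
  choose ψ hψ using fun p : (𝒜.toWeierstrassAlgebra h𝒜).Point v =>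
    exists_hom_unionSubalgebra (hR := 𝒜.monotone_ring)
      (fun n => (Pi.evalRingHom (fun _ => v.integer) (coords p n n)).comp (σ.σ n n))
      fun n f h h' => σ.σ_coords_mono p n.le_succ n.le_succ h h'
  have hψ' : ∀ (p : (𝒜.toWeierstrassAlgebra h𝒜).Point v) m n f (h : f ∈ 𝒜.ring m n) h',
      ψ p ⟨f, h'⟩ = σ.σ m n ⟨f, h⟩ (coords p m n) := by
    intro p m n f h h'
    have hmem := 𝒜.ring_mono (le_max_left m n) (le_max_right m n) h
    exact (hψ p (max m n) f hmem).trans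
      (σ.σ_coords_mono p (le_max_left m n) (le_max_right m n) h hmem)
  refine ⟨⟨ψ, fun p s => ?_, fun p p' S f hf hS => ?_⟩, hψ'⟩
  · rcases s with i | j
    · exact (hψ' p (i + 1) 0 _ (𝒜.X_mem (s := Sum.inl i) i.lt_succ_self) _).trans
        (σ.map_xi (i + 1) 0 (Fin.last i) _)
    · exact (hψ' p 0 (j + 1) _ (𝒜.X_mem (s := Sum.inr j) j.lt_succ_self) _).trans
        (σ.map_rho 0 (j + 1) (Fin.last j) _)
  · obtain ⟨f, hfB⟩ := f
    obtain ⟨n, hn⟩ := id hfB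
    exact (hψ' p n n f hn hfB).trans
      ((σ.σ_congr ⟨f, hn⟩ hf hS).trans (hψ' p' n n f hn hfB).symm)

theorem mem_toWeierstrassAlgebra {m n : ℕ} {f : MvPowerSeries (ℕ ⊕ ℕ) A} (h : f ∈ 𝒜.ring m n) :
    f ∈ (𝒜.toWeierstrassAlgebra h𝒜).B :=
  ⟨max m n, 𝒜.ring_mono (le_max_left m n) (le_max_right m n) h⟩

variable (h𝒜) in
/-- The separated analytic structure defined by an evaluation. -/
noncomputable def ofEvaluation (τ : (𝒜.toWeierstrassAlgebra h𝒜).Evaluation v)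
    (hτ : ∀ a ∈ I, ∀ p, v (τ.hom p (algebraMap A _ a) : K) < 1) : SeparatedStructure 𝒜 v where
  σ m n := RingHom.pi fun q => (τ.hom (pointOf h𝒜 q)).comp
    (Subalgebra.inclusion fun _ h => mem_toWeierstrassAlgebra h).toRingHom
  map_ideal a ha p := hτ a ha (pointOf h𝒜 p)
  map_xi m n i p := (τ.map_X (pointOf h𝒜 p) (Sum.inl i)).trans (pointOf_inl p i)
  map_rho m n j p := (τ.map_X (pointOf h𝒜 p) (Sum.inr j)).trans (pointOf_inr p j)
  map_incl_xi m n f x y := by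
    refine τ.congr _ _ (sepVars m n) ⟨f, mem_toWeierstrassAlgebra f.2⟩ (𝒜.onlyVars m n f f.2) ?_
    rintro (i | j) hs
    · exact (pointOf_inl (x, y) ⟨i, Nat.lt_succ_of_lt hs⟩).trans
        (pointOf_inl (fun i : Fin m => x i.castSucc, y) ⟨i, hs⟩).symm
    · exact (pointOf_inr (x, y) ⟨j, hs⟩).trans
        (pointOf_inr (fun i : Fin m => x i.castSucc, y) ⟨j, hs⟩).symm
  map_incl_rho m n f x y := by
    refine τ.congr _ _ (sepVars m n) ⟨f, mem_toWeierstrassAlgebra f.2⟩ (𝒜.onlyVars m n f f.2) ?_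
    rintro (i | j) hs
    · exact (pointOf_inl (x, y) ⟨i, hs⟩).trans
        (pointOf_inl (x, fun j : Fin n => y j.castSucc) ⟨i, hs⟩).symm
    · exact (pointOf_inr (x, y) ⟨j, Nat.lt_succ_of_lt hs⟩).trans
        (pointOf_inr (x, fun j : Fin n => y j.castSucc) ⟨j, hs⟩).symm
  indep_xi m n f i hf x y a := by
    refine τ.congr _ _ _ ⟨f, mem_toWeierstrassAlgebra f.2⟩
      ((𝒜.onlyVars m n f f.2).inter hf) ?_
    rintro (k | k) ⟨hk, hki⟩
    · refine (pointOf_inl (Function.update x i a, y) ⟨k, hk⟩).trans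
        (Eq.trans ?_ (pointOf_inl (x, y) ⟨k, hk⟩).symm)
      exact Function.update_of_ne (fun h => hki (by rw [← h]; rfl)) _ _
    · exact (pointOf_inr (Function.update x i a, y) ⟨k, hk⟩).trans
        (pointOf_inr (x, y) ⟨k, hk⟩).symm
  indep_rho m n f j hf x y b := by
    refine τ.congr _ _ _ ⟨f, mem_toWeierstrassAlgebra f.2⟩
      ((𝒜.onlyVars m n f f.2).inter hf) ?_
    rintro (k | k) ⟨hk, hkj⟩
    · exact (pointOf_inl (x, Function.update y j b) ⟨k, hk⟩).trans
        (pointOf_inl (x, y) ⟨k, hk⟩).symm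
    · refine (pointOf_inr (x, Function.update y j b) ⟨k, hk⟩).trans
        (Eq.trans ?_ (pointOf_inr (x, y) ⟨k, hk⟩).symm)
      exact congrArg Subtype.val (Function.update_of_ne (fun h => hkj (by rw [← h]; rfl)) _ _)

variable {K' : Type*} [Field K'] {Γ' : Type*} [LinearOrderedCommGroupWithZero Γ'] [Algebra K K']
  {v' : Valuation K' Γ'} [v.HasExtension v'] [Algebra.IsAlgebraic K K']

theorem existsUnique_extends (h𝒜 : 𝒜.IsPreWeierstrass) (σ : SeparatedStructure 𝒜 v) :
    ∃! τ : SeparatedStructure 𝒜 v', τ.Extends σ := by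
  obtain ⟨ε, hε⟩ := σ.exists_evaluation h𝒜
  have hgen : ε.IsGeneric := fun a ha =>
    ⟨a, fun p => by
      change a = ε.hom p (algebraMap A _ 1) * a
      rw [map_one, map_one, one_mul], fun _ _ _ => ha⟩
  obtain ⟨τ, hτ⟩ := ε.exists_extends (v' := v') hgen
  have hconst : ∀ a ∈ I, ∀ p, v' (τ.hom p (algebraMap A _ a) : K') < 1 := by
    intro a ha p
    have h0 : v ((ε.hom (pointOf h𝒜 (v := v) (m := 0) (n := 0) (Fin.elim0, Fin.elim0))
        (algebraMap A _ a) : v.integer) : K) < 1 := by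
      have := hε (pointOf h𝒜 (v := v) (m := 0) (n := 0) (Fin.elim0, Fin.elim0)) 0 0 _
        ((𝒜.ring 0 0).algebraMap_mem a) (Subalgebra.algebraMap_mem _ a)
      exact lt_of_eq_of_lt (congrArg (fun z : v.integer => v (z : K)) this)
        (σ.map_ideal a ha _)
    -- A constant has the same value at every point, so it may be evaluated at a point coming from
    -- `K`.
    rw [τ.congr p ((pointOf h𝒜 (v := v) (m := 0) (n := 0) (Fin.elim0, Fin.elim0)).map v') ∅
      (algebraMap A _ a) ((onlyVarsSubalgebra A ∅).algebraMap_mem a) (fun s hs => hs.elim), hτ]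
    exact (Valuation.HasExtension.val_map_lt_one_iff v v' _).2 h0
  refine ⟨ofEvaluation h𝒜 τ hconst, fun m n f x y => ?_, fun τ' hτ' => ?_⟩
  · have hp : pointOf h𝒜 (fun i => algebraMap v.integer v'.integer (x i),
        fun j => OpenDisc.map v v' (y j)) = (pointOf h𝒜 (x, y)).map v' := by
      refine Subtype.ext (funext fun s => ?_)
      rcases s with i | j
      · simp only [pointOf, WeierstrassAlgebra.Point.map, Sum.elim_inl]
        split_ifs
        · rfl
        · exact (map_zero _).symm
      · simp only [pointOf, WeierstrassAlgebra.Point.map, Sum.elim_inr]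
        split_ifs
        · rfl
        · exact (map_zero _).symm
    have h1 := hτ (pointOf h𝒜 (x, y)) ⟨f, mem_toWeierstrassAlgebra f.2⟩
    rw [hε _ m n f f.2, coords_pointOf, ← hp] at h1
    exact h1
  -- A second structure also evaluates the union of the rings, and its evaluation extends `ε`.
  -- Uniqueness for evaluations then applies.
  · obtain ⟨ε', hε'⟩ := τ'.exists_evaluation h𝒜
    have hext : ε'.Extends ε := by
      rintro p ⟨f, hfB⟩
      obtain ⟨n, hn⟩ := id hfB
      rw [hε' _ n n f hn, hε _ n n f hn]
      exact hτ' n n ⟨f, hn⟩ (coords p n n).1 (coords p n n).2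
    have heq : ε' = τ := hext.unique hgen hτ
    refine SeparatedStructure.ext (funext fun m => funext fun n => RingHom.ext fun f =>
      funext fun q => ?_)
    have h1 := hε' (pointOf h𝒜 q) m n f f.2 (mem_toWeierstrassAlgebra f.2)
    rw [coords_pointOf, heq] at h1
    exact h1.symm

end SeparatedStructure

end Separated

end AnalyticStructure

/-! ### The strictly convergent case. -/

namespace AnalyticStructure

open Filter

section Strict

variable {A : Type*} [CommRing A] {I : Ideal A}

namespace StrictSystem

variable (𝒜 : StrictSystem A I)

theorem monotone_ring : Monotone 𝒜.ring :=
  fun _ _ h => 𝒜.ring_mono h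

theorem hasDivision (h𝒜 : 𝒜.IsPreWeierstrass) (i d : ℕ)
    (c : ℕ → MvPowerSeries ℕ A) (h : MvPowerSeries ℕ A)
    (hc : ∀ k < d, c k ∈ unionSubalgebra _ 𝒜.monotone_ring ∧ OnlyVars {i}ᶜ (c k))
    (hh : h ∈ unionSubalgebra _ 𝒜.monotone_ring) (hnil : h ∈ residueIdeal ℕ I) :
    HasDivision (unionSubalgebra _ 𝒜.monotone_ring) i d
      (MvPowerSeries.X i ^ d + ∑ k ∈ Finset.range d, c k * MvPowerSeries.X i ^ k + h) := by
  refine hasDivision_unionSubalgebra ?_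
  have hcev : ∀ᶠ n in atTop, ∀ k ∈ Finset.range d, c k ∈ 𝒜.ring n :=
    (Finset.eventually_all _).2 fun k hk =>
      eventually_mem_of_mem_unionSubalgebra (hc k (Finset.mem_range.1 hk)).1
  filter_upwards [hcev, eventually_mem_of_mem_unionSubalgebra hh, eventually_gt_atTop i]
    with n hcn hhn hin
  have hX : MvPowerSeries.X i ∈ 𝒜.ring n := 𝒜.X_mem hin
  refine fun g hg => h𝒜 n i d hin _ ?_ g hg ⟨_, ⟨_, ⟨c, fun k hk => ?_, rfl⟩, rfl⟩, ?_⟩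
  · exact add_mem (add_mem (pow_mem hX _)
      (sum_mem fun k hk => mul_mem (hcn k hk) (pow_mem hX _))) hhn
  · exact (𝒜.onlyVars n _ (hcn k (Finset.mem_range.2 hk))).inter (hc k hk).2
  · rwa [add_sub_cancel_left]

/-- The union of the rings `Aₘ` of a strictly convergent Weierstrass system. -/
noncomputable def toWeierstrassAlgebra (h𝒜 : 𝒜.IsPreWeierstrass) {π : A} (hπ : π ∈ I) :
    WeierstrassAlgebra ℕ A where
  B := unionSubalgebra _ 𝒜.monotone_ring
  small := ∅
  nil := residueIdeal ℕ I
  -- There are no open-disc variables here: small coefficients are values of `π ξ_i`, which lies in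
  -- the residue ideal because `π ∈ I`.
  e := π
  Z := Set.univ
  X_mem s := ⟨s + 1, 𝒜.X_mem s.lt_succ_self⟩
  exists_finset := by
    rintro f ⟨n, hn⟩
    refine ⟨Finset.range n, (𝒜.onlyVars n f hn).mono ?_⟩
    rw [Finset.coe_range]
  infinite_kind s := by simpa using Set.infinite_univ
  exists_not_small := ⟨0, id⟩
  infinite_Z := Set.infinite_univ
  e_mul_X_mem t _ := by
    rw [residueIdeal, RingHom.mem_ker, map_mul, MvPowerSeries.algebraMap_apply,
      Algebra.algebraMap_self, RingHom.id_apply, MvPowerSeries.map_C,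
      Ideal.Quotient.eq_zero_iff_mem.2 hπ, map_zero, zero_mul]
  division_xi s _ d c h hc hh hn := 𝒜.hasDivision h𝒜 s d c h hc hh hn
  division_rho _ hs := hs.elim

end StrictSystem

/-- A prime element of a valuation ring generates the maximal ideal: if `ϖ = a * b` and `ϖ` divides
`b`, then `a` is a unit. This makes a strictly convergent structure generic. -/
theorem dvd_of_prime_of_lt_one {K : Type*} [Field K] {Γ : Type*}
    [LinearOrderedCommGroupWithZero Γ] {v : Valuation K Γ} {ϖ a : v.integer} (hϖ : Prime ϖ)
    (ha : v (a : K) < 1) : ϖ ∣ a := by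
  have hint := Valuation.integer.integers v
  rcases le_total (v (a : K)) (v (ϖ : K)) with h | h
  · exact hint.dvd_of_le h
  · obtain ⟨b, hb⟩ : a ∣ ϖ := hint.dvd_of_le h
    rcases hϖ.dvd_or_dvd (dvd_of_eq hb) with hd | ⟨c, hc⟩
    · exact hd
    · exfalso
      have h1 : a * c = 1 := by
        refine mul_left_cancel₀ hϖ.ne_zero ?_
        rw [mul_one]
        nth_rewrite 2 [hb]
        rw [hc]
        ring
      have h2 : v ((a * c : v.integer) : K) = 1 := by
        rw [h1]
        exact map_one v
      rw [Subring.coe_mul, map_mul] at h2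
      exact (mul_lt_one_of_lt_of_le ha c.2).ne h2

namespace StrictStructure

variable {𝒜 : StrictSystem A I} {h𝒜 : 𝒜.IsPreWeierstrass} {π : A} {hπ : π ∈ I}
  {K : Type*} [Field K] {Γ : Type*} [LinearOrderedCommGroupWithZero Γ] {v : Valuation K Γ}

/-- The first coordinates of a point. -/
def coords (p : (𝒜.toWeierstrassAlgebra h𝒜 hπ).Point v) (m : ℕ) : Fin m → v.integer :=
  fun i => p.1 i

open Classical in
variable (h𝒜 hπ) in
/-- The point with the given first coordinates, the other coordinates being `0`. -/
noncomputable def pointOf {m : ℕ} (x : Fin m → v.integer) :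
    (𝒜.toWeierstrassAlgebra h𝒜 hπ).Point v :=
  ⟨fun i => if h : i < m then x ⟨i, h⟩ else 0, fun _ h => h.elim⟩

theorem pointOf_apply {m : ℕ} (x : Fin m → v.integer) (i : Fin m) :
    (pointOf h𝒜 hπ x).1 (i : ℕ) = x i :=
  dif_pos i.2

theorem coords_pointOf {m : ℕ} (x : Fin m → v.integer) : coords (pointOf h𝒜 hπ x) m = x := by
  funext i
  exact pointOf_apply (h𝒜 := h𝒜) (hπ := hπ) x i

variable (h𝒜 hπ) in
/-- A strictly convergent analytic structure evaluates the series in the union of the rings `Aₘ`. -/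
theorem exists_evaluation (σ : StrictStructure 𝒜 π v) :
    ∃ ε : (𝒜.toWeierstrassAlgebra h𝒜 hπ).Evaluation v, ∀ p m f (h : f ∈ 𝒜.ring m) h',
      ε.hom p ⟨f, h'⟩ = σ.σ m ⟨f, h⟩ (coords p m) := by
  choose ψ hψ using fun p : (𝒜.toWeierstrassAlgebra h𝒜 hπ).Point v =>
    exists_hom_unionSubalgebra (hR := 𝒜.monotone_ring)
      (fun n => (Pi.evalRingHom (fun _ => v.integer) (coords p n)).comp (σ.σ n))
      fun n f h _ => σ.map_incl n ⟨f, h⟩ _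
  have hψ' : ∀ (p : (𝒜.toWeierstrassAlgebra h𝒜 hπ).Point v) m f (h : f ∈ 𝒜.ring m) h',
      ψ p ⟨f, h'⟩ = σ.σ m ⟨f, h⟩ (coords p m) := fun p m f h _ => hψ p m f h
  refine ⟨⟨ψ, fun p s => ?_, fun p p' S f hf hS => ?_⟩, hψ'⟩
  · exact (hψ' p (s + 1) _ (𝒜.X_mem s.lt_succ_self) _).trans (σ.map_xi (s + 1) (Fin.last s) _)
  · obtain ⟨f, hfB⟩ := f
    obtain ⟨n, hn⟩ := id hfB
    refine (hψ' p n f hn hfB).trans (Eq.trans ?_ (hψ' p' n f hn hfB).symm)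
    exact eq_of_update_eq (σ.σ n ⟨f, hn⟩) {i | (i : ℕ) ∈ S}
      (fun i hi x a => σ.indep_xi n ⟨f, hn⟩ i (hf.compl_singleton hi) x a) fun i hi => hS _ hi

theorem mem_toWeierstrassAlgebra {m : ℕ} {f : MvPowerSeries ℕ A} (h : f ∈ 𝒜.ring m) :
    f ∈ (𝒜.toWeierstrassAlgebra h𝒜 hπ).B :=
  ⟨m, h⟩

variable (h𝒜 hπ) in
/-- The strictly convergent analytic structure defined by an evaluation. -/
noncomputable def ofEvaluation (τ : (𝒜.toWeierstrassAlgebra h𝒜 hπ).Evaluation v)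
    (hτ : ∀ a ∈ I, ∀ p, v (τ.hom p (algebraMap A _ a) : K) < 1)
    (hprime : ∀ p, Prime (τ.hom p (algebraMap A _ π))) : StrictStructure 𝒜 π v where
  σ m := RingHom.pi fun x => (τ.hom (pointOf h𝒜 hπ x)).comp
    (Subalgebra.inclusion fun _ h => mem_toWeierstrassAlgebra h).toRingHom
  map_ideal a ha p := hτ a ha (pointOf h𝒜 hπ p)
  prime x := hprime (pointOf h𝒜 hπ x)
  map_xi m i x := (τ.map_X (pointOf h𝒜 hπ x) (i : ℕ)).trans (pointOf_apply x i)
  map_incl m f x := by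
    refine τ.congr _ _ (Set.Iio m) ⟨f, mem_toWeierstrassAlgebra f.2⟩ (𝒜.onlyVars m f f.2)
      fun i hi => ?_
    exact (pointOf_apply x ⟨i, Nat.lt_succ_of_lt hi⟩).trans
      (pointOf_apply (fun i : Fin m => x i.castSucc) ⟨i, hi⟩).symm
  indep_xi m f i hf x a := by
    refine τ.congr _ _ _ ⟨f, mem_toWeierstrassAlgebra f.2⟩ ((𝒜.onlyVars m f f.2).inter hf) ?_
    rintro k ⟨hk, hki⟩
    refine (pointOf_apply (Function.update x i a) ⟨k, hk⟩).trans
      (Eq.trans ?_ (pointOf_apply x ⟨k, hk⟩).symm)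
    exact Function.update_of_ne (fun h => hki (by rw [← h]; rfl)) _ _

variable {K' : Type*} [Field K'] {Γ' : Type*} [LinearOrderedCommGroupWithZero Γ'] [Algebra K K']
  {v' : Valuation K' Γ'} [v.HasExtension v'] [Algebra.IsAlgebraic K K']

theorem existsUnique_extends (h𝒜 : 𝒜.IsPreWeierstrass) (hπ : π ∈ I) (σ : StrictStructure 𝒜 π v)
    (hσ : ∀ x, Prime (algebraMap v.integer v'.integer (σ.σ 0 (algebraMap A _ π) x))) :
    ∃! τ : StrictStructure 𝒜 π v', τ.Extends σ := by
  obtain ⟨ε, hε⟩ := σ.exists_evaluation h𝒜 hπ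
  have hεconst : ∀ a p, ε.hom p (algebraMap A _ a) = σ.σ 0 (algebraMap A _ a) (coords p 0) :=
    fun a p => hε p 0 _ ((𝒜.ring 0).algebraMap_mem a) (Subalgebra.algebraMap_mem _ a)
  have hgen : ε.IsGeneric := by
    intro a ha
    -- The variable standing for a small coefficient takes as its value the quotient by `σ₀(π)`,
    -- which is only required to lie in `K°`.
    obtain ⟨x, hx⟩ := dvd_of_prime_of_lt_one (σ.prime Fin.elim0) ha
    refine ⟨x, fun p => ?_, fun _ _ h => h.elim⟩
    rw [hx]
    congr 1
    refine (Eq.trans (hεconst π p) ?_).symm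
    rw [Subsingleton.elim (coords p 0) Fin.elim0]
  obtain ⟨τ, hτ⟩ := ε.exists_extends (v' := v') hgen
  have hτconst : ∀ a p, τ.hom p (algebraMap A _ a) =
      algebraMap v.integer v'.integer (σ.σ 0 (algebraMap A _ a) Fin.elim0) := by
    intro a p
    rw [τ.congr p ((pointOf h𝒜 hπ (v := v) (m := 0) Fin.elim0).map v') ∅
      (algebraMap A _ a) ((onlyVarsSubalgebra A ∅).algebraMap_mem a) (fun s hs => hs.elim), hτ,
      hεconst, coords_pointOf]
  refine ⟨ofEvaluation h𝒜 hπ τ (fun a ha p => ?_) fun p => ?_, fun m f x => ?_, fun τ' hτ' => ?_⟩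
  · rw [hτconst]
    exact (Valuation.HasExtension.val_map_lt_one_iff v v' _).2 (σ.map_ideal a ha _)
  · rw [hτconst]
    exact hσ _
  · have hp : pointOf h𝒜 hπ (fun i => algebraMap v.integer v'.integer (x i)) =
        (pointOf h𝒜 hπ x).map v' := by
      refine Subtype.ext (funext fun i => ?_)
      simp only [pointOf, WeierstrassAlgebra.Point.map]
      split_ifs
      · rfl
      · exact (map_zero _).symm
    have h1 := hτ (pointOf h𝒜 hπ x) ⟨f, mem_toWeierstrassAlgebra f.2⟩
    rw [hε _ m f f.2, coords_pointOf, ← hp] at h1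
    exact h1
  · obtain ⟨ε', hε'⟩ := τ'.exists_evaluation h𝒜 hπ
    have hext : ε'.Extends ε := by
      rintro p ⟨f, hfB⟩
      obtain ⟨n, hn⟩ := id hfB
      rw [hε' _ n f hn, hε _ n f hn]
      exact hτ' n ⟨f, hn⟩ (coords p n)
    have heq : ε' = τ := hext.unique hgen hτ
    refine StrictStructure.ext (funext fun m => RingHom.ext fun f => funext fun x => ?_)
    have h1 := hε' (pointOf h𝒜 hπ x) m f f.2 (mem_toWeierstrassAlgebra f.2)
    rw [coords_pointOf, heq] at h1
    exact h1.symm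

end StrictStructure

end Strict

end AnalyticStructure

theorem mainTheorem9 {A : Type*} [CommRing A] (I : Ideal A) (hI : I ≠ ⊤)
    {K : Type*} [Field K] {Γ : Type*} [LinearOrderedCommGroupWithZero Γ] (v : Valuation K Γ)
    {K' : Type*} [Field K'] {Γ' : Type*} [LinearOrderedCommGroupWithZero Γ']
    (v' : Valuation K' Γ') [Algebra K K'] [Algebra.IsAlgebraic K K'] [v.HasExtension v'] :
    (∀ 𝒜 : AnalyticStructure.SeparatedSystem A I, 𝒜.IsWeierstrass →
      ∀ σ : AnalyticStructure.SeparatedStructure 𝒜 v,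
        ∃! τ : AnalyticStructure.SeparatedStructure 𝒜 v', τ.Extends σ) ∧
    (∀ π ∈ I, ∀ 𝒜 : AnalyticStructure.StrictSystem A I, 𝒜.IsWeierstrass π →
      ∀ σ : AnalyticStructure.StrictStructure 𝒜 π v,
        (∀ x, Prime (algebraMap v.integer v'.integer (σ.σ 0 (algebraMap A _ π) x))) →
        ∃! τ : AnalyticStructure.StrictStructure 𝒜 π v', τ.Extends σ) :=
  ⟨fun _ h𝒜 σ => σ.existsUnique_extends h𝒜.toIsPreWeierstrass,
    fun _ hπ _ h𝒜 σ hσ => σ.existsUnique_extends h𝒜.isPreWeierstrass hπ hσ⟩
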